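/- Let $q$ be an odd prime power, let $G=SL_2(\mathbb{F}_q)$, and let $R(G)$ be the ring generated by the isomorphism classes of finite-dimensional complex representations of $G$, with addition given by the direct sum $\oplus$ and multiplication by the tensor product $\otimes$. For an integer $k\ge 0$ let $F^k\subseteq R(G)$ be the subgroup spanned by the classes of those irreducible representations (irreps) that occur in some $\ell$-fold tensor product, $0\le \ell\le k$, of irreps of $G$ of dimension $\frac{q-1}{2}$ or $\frac{q+1}{2}$; the $0$-fold tensor product is the trivial representation. A representation $\rho$ of $G$ has tensor rank $k$ if its class lies in $F^k$ and, when $k\ge 1$, not in $F^{k-1}$. Then: 1. $F^2=R(G)$. Hence every irrep of $G$ has tensor rank $0$, $1$ or $2$. 2. An irrep of $G$ has tensor rank $0$ if and only if it is the trivial representation. 3. If $q>3$, then there are, up to isomorphism, exactly four irreps of $G$ of dimension $\frac{q\pm1}{2}$; an irrep of $G$ has tensor rank $1$ if and only if its dimension is $\frac{q-1}{2}$ or $\frac{q+1}{2}$, and it has tensor rank $2$ if and only if its dimension is $q-1$, $q$ or $q+1$. -/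

import Mathlib

open CategoryTheory MonoidalCategory Limits

namespace TensorRank

noncomputable section

universe u

/-- The commutative ring freely spanned over `ℤ` by the isomorphism classes of finite-dimensional
complex representations of `G`, multiplied by the tensor product
(in `Skeleton`, the product of the classes of `V` and `W` is the class of `V ⊗ W`). -/
abbrev FreeRepRing (G : Type u) [Group G] : Type (max 1 u) :=
  MonoidAlgebra ℤ (Skeleton (FDRep ℂ G))

/-- The generator attached to the isomorphism class of `V`. -/
def freeClass {G : Type u} [Group G] (V : FDRep ℂ G) : FreeRepRing G :=
  MonoidAlgebra.of ℤ (Skeleton (FDRep ℂ G)) (toSkeleton V)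

/-- The relations identifying addition with direct sum. -/
def directSumIdeal (G : Type u) [Group G] : Ideal (FreeRepRing G) :=
  Ideal.span {x | ∃ V W : FDRep ℂ G, x = freeClass (V ⊞ W) - (freeClass V + freeClass W)}

/-- The (complex) representation ring `R(G)`: addition is direct sum, multiplication is tensor
product. -/
abbrev RepRing (G : Type u) [Group G] : Type (max 1 u) :=
  FreeRepRing G ⧸ directSumIdeal G

/-- The class of a representation in `R(G)`. -/
def repClass {G : Type u} [Group G] (V : FDRep ℂ G) : RepRing G :=
  Ideal.Quotient.mk (directSumIdeal G) (freeClass V)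

/-- The tensor product of a list of representations; the empty product is the trivial
representation. -/
def tensorList {G : Type u} [Group G] (L : List (FDRep ℂ G)) : FDRep ℂ G :=
  L.foldr (fun V W => V ⊗ W) (𝟙_ (FDRep ℂ G))

/-- `G = SL₂(F)`. -/
abbrev SL2 (F : Type u) [Field F] : Type u :=
  Matrix.SpecialLinearGroup (Fin 2) F

/-- The irreducible representations of `SL₂(F_q)` of dimension `(q ± 1) / 2`. The divisions in `ℕ`
are exact when `q` is odd. -/
def IsHalfIrrep {F : Type u} [Field F] (V : FDRep ℂ (SL2 F)) : Prop :=
  Simple V ∧ (Module.finrank ℂ V = (Nat.card F - 1) / 2 ∨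
    Module.finrank ℂ V = (Nat.card F + 1) / 2)

/-- The `k`-th step of the tensor rank filtration: the subgroup of `R(SL₂(F_q))` spanned by the
classes of the irreducible representations that occur in some `ℓ`-fold tensor product, `ℓ ≤ k`, of
irreducible representations of dimension `(q ± 1) / 2`. -/
def tensorFiltration (F : Type u) [Field F] (k : ℕ) : AddSubgroup (RepRing (SL2 F)) :=
  AddSubgroup.closure {x | ∃ (W : FDRep ℂ (SL2 F)) (L : List (FDRep ℂ (SL2 F))),
    Simple W ∧ L.length ≤ k ∧ (∀ V ∈ L, IsHalfIrrep V) ∧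
    (∃ f : W ⟶ tensorList L, Mono f) ∧ x = repClass W}

/-- `V` has tensor rank `k`: its class lies in the `k`-th step of the filtration and, if `k > 0`,
not in the `(k - 1)`-st step. -/
def HasTensorRank {F : Type u} [Field F] (V : FDRep ℂ (SL2 F)) (k : ℕ) : Prop :=
  repClass V ∈ tensorFiltration F k ∧ ∀ j, k = j + 1 → repClass V ∉ tensorFiltration F j

end

end TensorRank

/-! ### Maschke's theorem and complete reducibility -/

namespace TensorRank
noncomputable section
universe u
variable {G : Type u} [Group G]

/-! Restrict an irrep V to the unipotent subgroup U ≅ F and let m_a be the multiplicity of ψ(a·),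
with ψ primitive. The torus scales a by squares, so only m_0, m_1, m_ε matter (ε a nonsquare), and
dim V = m_0 + (q-1)/2 · (m_1 + m_ε). Uniqueness of Whittaker models (`unipMult_le_one`, by Gelfand's
trick) gives m_1, m_ε ≤ 1. The number m_0 is a sum of multiplicities of Borel characters, controlled
by the intertwining numbers of principal series (`sum_borelMult_mul`). These intertwining numbers
come from column orthogonality and the Bruhat decomposition, without constructing induced
representations.

The outcome (`simple_cases`) is: the trivial irrep; irreps with m_1 + m_ε = 1 and m_0 ≤ 1, of
dimension (q±1)/2; and irreps with m_1 = m_ε = 1 and m_0 ∈ {0, 1, 2}, of dimension q-1, q, q+1.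
Summing (m_1 - m_ε)² over all irreps gives 4, which counts the half-dimensional ones.

For F² = R(G), V occurs in Y ⊗ X* as soon as Y occurs in V ⊗ X, so a half irrep X with a half
constituent Y of V ⊗ X suffices. If m_1 = m_ε = 1 and m_0 ≠ 1, then V|U is the regular
representation plus m_0 - 1 copies of the trivial one; hence V ⊗ X inherits the asymmetry m_1 ≠ m_ε
of X, and some constituent must be asymmetric, that is, half. For m_0 = 1 (Steinberg) this says
nothing; instead a Borel-fixed vector of V times a quadratic Borel eigenvector of X is again a
quadratic eigenvector, and irreps containing one are half.

The lower bounds on rank follow because pairing with a character detects which irreps span a step of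
the filtration; for q > 3 the dimensions of the three types are distinct. -/

def homLin {V W : FDRep ℂ G} (f : V ⟶ W) : V →ₗ[ℂ] W := f.hom.hom.hom

@[simp] lemma homLin_comp {U V W : FDRep ℂ G} (f : U ⟶ V) (g : V ⟶ W) :
    homLin (f ≫ g) = homLin g ∘ₗ homLin f := rfl

@[simp] lemma homLin_id (V : FDRep ℂ G) : homLin (𝟙 V) = LinearMap.id := rfl

@[simp] lemma homLin_add {V W : FDRep ℂ G} (f g : V ⟶ W) :
    homLin (f + g) = homLin f + homLin g := rfl

@[simp] lemma homLin_zero {V W : FDRep ℂ G} : homLin (0 : V ⟶ W) = 0 := rfl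

@[simp] lemma homLin_smul {V W : FDRep ℂ G} (c : ℂ) (f : V ⟶ W) :
    homLin (c • f) = c • homLin f := rfl

lemma homLin_comm {V W : FDRep ℂ G} (f : V ⟶ W) (g : G) :
    homLin f ∘ₗ V.ρ g = W.ρ g ∘ₗ homLin f := by
  have := f.comm g
  exact congrArg (fun h => h.hom.hom) this

lemma homLin_injective {V W : FDRep ℂ G} {f g : V ⟶ W} (h : homLin f = homLin g) : f = g := by
  apply Action.Hom.ext
  apply InducedCategory.hom_ext
  exact ModuleCat.hom_ext h

def homOfLin {V W : FDRep ℂ G} (f : V →ₗ[ℂ] W)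
    (hf : ∀ g, f ∘ₗ V.ρ g = W.ρ g ∘ₗ f) : V ⟶ W :=
  ⟨InducedCategory.homMk (ModuleCat.ofHom f), fun g => by
    apply InducedCategory.hom_ext
    exact ModuleCat.hom_ext (hf g)⟩

@[simp] lemma homLin_homOfLin {V W : FDRep ℂ G} (f : V →ₗ[ℂ] W)
    (hf : ∀ g, f ∘ₗ V.ρ g = W.ρ g ∘ₗ f) : homLin (homOfLin f hf) = f := rfl

lemma homLin_mono_injective {V W : FDRep ℂ G} (f : V ⟶ W) [Mono f] :
    Function.Injective (homLin f) := by
  have : Mono ((forget₂ (FDRep ℂ G) (Rep ℂ G)).map f) := inferInstance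
  exact (Rep.mono_iff_injective _).1 this

/-- Maschke: average the conjugates of a linear left inverse over the group. -/
lemma exists_retraction [Finite G] {W V : FDRep ℂ G} (f : W ⟶ V) [Mono f] :
    ∃ r : V ⟶ W, f ≫ r = 𝟙 W := by
  have := Fintype.ofFinite G
  obtain ⟨r0, hr0⟩ := LinearMap.exists_leftInverse_of_injective (homLin f)
    (LinearMap.ker_eq_bot.2 (homLin_mono_injective f))
  have hr0' (w : W) : r0 (homLin f w) = w := LinearMap.congr_fun hr0 w
  let r1 : V →ₗ[ℂ] W := (Fintype.card G : ℂ)⁻¹ • ∑ g : G, W.ρ g⁻¹ ∘ₗ r0 ∘ₗ V.ρ g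
  have h1 : ∀ g, r1 ∘ₗ V.ρ g = W.ρ g ∘ₗ r1 := by
    intro g
    ext v
    simp only [r1, LinearMap.comp_apply, LinearMap.smul_apply, LinearMap.sum_apply, map_smul,
      map_sum]
    congr 1
    refine Fintype.sum_equiv (Equiv.mulRight g) _ _ fun x => ?_
    simp only [Equiv.coe_mulRight, mul_inv_rev, map_mul, Module.End.mul_apply]
    rw [← Module.End.mul_apply (W.ρ g), ← map_mul, mul_inv_cancel, map_one, Module.End.one_apply]
  refine ⟨homOfLin r1 h1, homLin_injective ?_⟩
  ext w
  have h2 (g : G) : V.ρ g (homLin f w) = homLin f (W.ρ g w) :=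
    (LinearMap.congr_fun (homLin_comm f g) w).symm
  simp only [homLin_comp, homLin_homOfLin, r1, LinearMap.comp_apply, LinearMap.smul_apply,
    LinearMap.sum_apply, h2, hr0']
  have h3 (g : G) : W.ρ g⁻¹ (W.ρ g w) = w := by
    rw [← Module.End.mul_apply, ← map_mul, inv_mul_cancel, map_one, Module.End.one_apply]
  simp only [h3, Finset.sum_const, Finset.card_univ]
  rw [← Nat.cast_smul_eq_nsmul ℂ, smul_smul, inv_mul_cancel₀ (by simp), one_smul]
  rfl

/-- The space underlying `V ⊞ W` is only known up to isomorphism, so the identity is split by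
`biprod.total` and each piece is rotated inside the trace. -/
lemma char_biprod (V W : FDRep ℂ G) (g : G) :
    (V ⊞ W).character g = V.character g + W.character g := by
  have h : (V ⊞ W).ρ g = (V ⊞ W).ρ g ∘ₗ (homLin (biprod.inl : V ⟶ V ⊞ W) ∘ₗ homLin biprod.fst) +
      (V ⊞ W).ρ g ∘ₗ (homLin (biprod.inr : W ⟶ V ⊞ W) ∘ₗ homLin biprod.snd) := by
    rw [← LinearMap.comp_add, ← homLin_comp, ← homLin_comp, ← homLin_add, biprod.total,
      homLin_id, LinearMap.comp_id]
  unfold FDRep.character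
  rw [h, map_add, ← LinearMap.comp_assoc, ← LinearMap.comp_assoc, ← homLin_comm, ← homLin_comm,
    LinearMap.comp_assoc, LinearMap.comp_assoc,
    LinearMap.trace_comp_comm' _ (homLin (biprod.inl : V ⟶ V ⊞ W)),
    LinearMap.trace_comp_comm' _ (homLin (biprod.inr : W ⟶ V ⊞ W)),
    LinearMap.comp_assoc, LinearMap.comp_assoc,
    ← homLin_comp, ← homLin_comp, biprod.inl_fst, biprod.inr_snd]
  simp

lemma finrank_biprod (V W : FDRep ℂ G) :
    Module.finrank ℂ (V ⊞ W : FDRep ℂ G) = Module.finrank ℂ V + Module.finrank ℂ W := by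
  have := char_biprod V W 1
  simp only [FDRep.char_one] at this
  exact_mod_cast this

lemma isZero_of_finrank_eq_zero {V : FDRep ℂ G} (h : Module.finrank ℂ V = 0) : IsZero V := by
  rw [IsZero.iff_id_eq_zero]
  apply homLin_injective
  have := Module.finrank_zero_iff.1 h
  ext v
  exact Subsingleton.elim _ _

lemma finrank_pos_of_simple (V : FDRep ℂ G) [Simple V] : 0 < Module.finrank ℂ V := by
  by_contra h
  exact Simple.not_isZero V (isZero_of_finrank_eq_zero (by omega))

lemma simple_or_decomp [Finite G] (V : FDRep ℂ G) (hV : 0 < Module.finrank ℂ V) :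
    Simple V ∨ ∃ W₁ W₂ : FDRep ℂ G, Nonempty (V ≅ W₁ ⊞ W₂) ∧
      0 < Module.finrank ℂ W₁ ∧ 0 < Module.finrank ℂ W₂ := by
  by_contra! H
  obtain ⟨hs, hd⟩ := H
  apply hs
  refine ⟨fun {W} f _ => ⟨fun hf h0 => ?_, fun hf => ?_⟩⟩
  · have : homLin (inv f ≫ f) = 0 := by simp [h0]
    rw [IsIso.inv_hom_id, homLin_id] at this
    have h1 : Subsingleton V := ⟨fun x y => by
      rw [← LinearMap.id_apply (R := ℂ) x, ← LinearMap.id_apply (R := ℂ) y, this]; rfl⟩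
    rw [Module.finrank_zero_of_subsingleton] at hV
    exact hV.ne rfl
  · obtain ⟨r, hr⟩ := exists_retraction f
    have : IsSplitMono f := ⟨⟨⟨r, hr⟩⟩⟩
    let c := binaryBiconeOfIsSplitMonoOfCokernel (cokernelIsCokernel f)
    let hc : c.IsBilimit := isBilimitBinaryBiconeOfIsSplitMonoOfCokernel (cokernelIsCokernel f)
    have e : V ≅ W ⊞ cokernel f := biprod.uniqueUpToIso _ _ hc
    have hW : 0 < Module.finrank ℂ W := by
      by_contra h
      exact hf ((isZero_of_finrank_eq_zero (by omega)).eq_of_src _ _)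
    -- Indecomposability leaves no room for the cokernel.
    have h2 := hd W (cokernel f) ⟨e⟩ hW
    have hz : IsZero (cokernel f) := isZero_of_finrank_eq_zero (by omega)
    have : Epi f := Preadditive.epi_of_isZero_cokernel f hz
    exact isIso_of_mono_of_epi f

lemma finrank_eq_of_iso {V W : FDRep ℂ G} (e : V ≅ W) : Module.finrank ℂ V = Module.finrank ℂ W :=
  (FDRep.isoToLinearEquiv e).finrank_eq

/-- Complete reducibility as an induction principle. -/
lemma rep_induction [Finite G] {P : FDRep ℂ G → Prop}
    (iso : ∀ V W : FDRep ℂ G, (V ≅ W) → P W → P V)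
    (zero : ∀ V : FDRep ℂ G, IsZero V → P V)
    (simple : ∀ V : FDRep ℂ G, Simple V → P V)
    (biprod : ∀ V W : FDRep ℂ G, P V → P W → P (V ⊞ W)) (V : FDRep ℂ G) : P V := by
  induction h : Module.finrank ℂ V using Nat.strong_induction_on generalizing V with
  | _ n ih =>
    rcases Nat.eq_zero_or_pos (Module.finrank ℂ V) with h0 | h0
    · exact zero V (isZero_of_finrank_eq_zero h0)
    · rcases simple_or_decomp V h0 with hs | ⟨W₁, W₂, ⟨e⟩, h1, h2⟩
      · exact simple V hs
      · have h3 := finrank_eq_of_iso e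
        rw [finrank_biprod] at h3
        exact iso _ _ e (biprod _ _ (ih _ (by omega) W₁ rfl) (ih _ (by omega) W₂ rfl))

end
end TensorRank

/-! ### Characters and orthogonality relations -/

namespace TensorRank
noncomputable section
universe u
variable {G : Type u} [Group G]

lemma rho_mul (V : FDRep ℂ G) (g h : G) : V.ρ (g * h) = V.ρ g * V.ρ h := map_mul _ _ _

lemma rho_inv_mul (V : FDRep ℂ G) (g : G) : V.ρ g⁻¹ * V.ρ g = 1 := by
  rw [← rho_mul, inv_mul_cancel, map_one]

lemma rho_mul_inv (V : FDRep ℂ G) (g : G) : V.ρ g * V.ρ g⁻¹ = 1 := by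
  rw [← rho_mul, mul_inv_cancel, map_one]

/-- Schur's lemma for averages. -/
lemma sum_conj_eq [Fintype G] (V : FDRep ℂ G) [Simple V] (A : Module.End ℂ V) :
    ∑ g : G, V.ρ g * A * V.ρ g⁻¹ =
      ((Fintype.card G : ℂ) * LinearMap.trace ℂ V A / Module.finrank ℂ V) •
        (1 : Module.End ℂ V) := by
  set S : Module.End ℂ V := ∑ g : G, V.ρ g * A * V.ρ g⁻¹ with hS
  have hcomm : ∀ h, S ∘ₗ V.ρ h = V.ρ h ∘ₗ S := by
    intro h
    change S * V.ρ h = V.ρ h * S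
    rw [hS, Finset.sum_mul, Finset.mul_sum]
    refine Fintype.sum_equiv (Equiv.mulLeft h⁻¹) _ _ fun x => ?_
    simp only [Equiv.coe_mulLeft, mul_inv_rev, inv_inv, rho_mul, mul_assoc]
    rw [← mul_assoc (V.ρ h) (V.ρ h⁻¹), rho_mul_inv, one_mul]
  obtain ⟨c, hc⟩ := endomorphism_simple_eq_smul_id ℂ (homOfLin S hcomm)
  have hc' : S = c • (1 : Module.End ℂ V) := by
    have := congrArg homLin hc
    rw [homLin_homOfLin, homLin_smul, homLin_id] at this
    exact this.symm
  have ht : LinearMap.trace ℂ V S = Fintype.card G * LinearMap.trace ℂ V A := by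
    rw [hS, map_sum]
    have : ∀ g : G, LinearMap.trace ℂ V (V.ρ g * A * V.ρ g⁻¹) = LinearMap.trace ℂ V A := by
      intro g
      rw [LinearMap.trace_mul_comm, ← mul_assoc, rho_inv_mul, one_mul]
    simp [this]
  have hD : (Module.finrank ℂ V : ℂ) ≠ 0 := by
    exact_mod_cast (finrank_pos_of_simple V).ne'
  rw [hc', map_smul, LinearMap.trace_one, smul_eq_mul] at ht
  rw [hc', ← ht, mul_div_cancel_right₀ _ hD]

lemma scalar_product_char [Fintype G] (V W : FDRep ℂ G) :
    (Fintype.card G : ℂ)⁻¹ * ∑ g : G, W.character g * V.character g⁻¹ =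
      Module.finrank ℂ (V ⟶ W) := by
  have := invertibleOfNonzero (NeZero.ne (Nat.card G : ℂ))
  rw [← FDRep.scalar_product_char_eq_finrank_equivariant, Nat.card_eq_fintype_card]

lemma finrank_hom_biprod_right [Finite G] (V W₁ W₂ : FDRep ℂ G) :
    Module.finrank ℂ (V ⟶ W₁ ⊞ W₂) = Module.finrank ℂ (V ⟶ W₁) + Module.finrank ℂ (V ⟶ W₂) := by
  have := Fintype.ofFinite G
  have h := scalar_product_char V (W₁ ⊞ W₂)
  simp only [char_biprod, add_mul, Finset.sum_add_distrib, mul_add, scalar_product_char] at h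
  exact_mod_cast h.symm

lemma finrank_hom_comm [Finite G] (V W : FDRep ℂ G) :
    Module.finrank ℂ (V ⟶ W) = Module.finrank ℂ (W ⟶ V) := by
  have := Fintype.ofFinite G
  have h := scalar_product_char V W
  rw [← Equiv.sum_comp (Equiv.inv G)] at h
  simp only [Equiv.inv_apply, inv_inv] at h
  simp only [mul_comm (W.character _)] at h
  rw [scalar_product_char] at h
  exact_mod_cast h.symm

lemma finrank_hom_congr [Finite G] {V V' W W' : FDRep ℂ G} (hV : V.character = V'.character)
    (hW : W.character = W'.character) :
    Module.finrank ℂ (V ⟶ W) = Module.finrank ℂ (V' ⟶ W') := by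
  have := Fintype.ofFinite G
  have h := scalar_product_char V W
  rw [hV, hW, scalar_product_char] at h
  exact_mod_cast h.symm

lemma char_zero {V : FDRep ℂ G} (h : IsZero V) (g : G) : V.character g = 0 := by
  have h1 := homLin_id V
  rw [(IsZero.iff_id_eq_zero V).1 h, homLin_zero] at h1
  have : V.ρ g = 0 := by rw [← LinearMap.comp_id (V.ρ g), ← h1, LinearMap.comp_zero]
  rw [FDRep.character, this, map_zero]

/-- The isomorphism classes of irreducible representations. -/
def Irr (G : Type u) [Group G] : Type (max 1 u) :=
  {s : Skeleton (FDRep ℂ G) // Simple ((fromSkeleton (FDRep ℂ G)).obj s)}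

/-- A representative of an isomorphism class of irreducible representations. -/
def irrep (i : Irr G) : FDRep ℂ G := (fromSkeleton (FDRep ℂ G)).obj i.1

instance (i : Irr G) : Simple (irrep i) := i.2

lemma exists_irrep (V : FDRep ℂ G) [Simple V] : ∃ i : Irr G, Nonempty (V ≅ irrep i) := by
  let e := fromSkeletonToSkeletonIso V
  exact ⟨⟨toSkeleton V, Simple.of_iso e⟩, ⟨e.symm⟩⟩

lemma irrep_eq {i j : Irr G} (h : Nonempty (irrep i ≅ irrep j)) : i = j := by
  apply Subtype.ext
  rw [← toSkeleton_fromSkeleton_obj i.1, ← toSkeleton_fromSkeleton_obj j.1]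
  exact toSkeleton_eq_toSkeleton_iff.2 h

lemma irrep_nonempty_iso_iff {i j : Irr G} : Nonempty (irrep i ≅ irrep j) ↔ i = j :=
  ⟨irrep_eq, fun h => h ▸ ⟨Iso.refl _⟩⟩

open Classical in
lemma finrank_hom_irrep (i j : Irr G) :
    Module.finrank ℂ (irrep i ⟶ irrep j) = if i = j then 1 else 0 := by
  rw [FDRep.finrank_hom_simple_simple]
  simp only [irrep_nonempty_iso_iff]

/-- Irreducible characters are linearly independent in the finite-dimensional space of functions on
G. -/
instance [Finite G] : Finite (Irr G) := by
  classical
  have := Fintype.ofFinite G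
  refine LinearIndependent.finite (R := ℂ) (f := fun i : Irr G => (irrep i).character) ?_
  rw [linearIndependent_iff']
  intro s c hc i hi
  have h := congrArg (fun f : G → ℂ => (Fintype.card G : ℂ)⁻¹ *
    ∑ g : G, f g * (irrep i).character g⁻¹) hc
  simp only [Finset.sum_apply, Pi.smul_apply, smul_eq_mul, Finset.sum_mul, Pi.zero_apply,
    zero_mul, Finset.sum_const_zero, mul_zero] at h
  rw [Finset.sum_comm, Finset.mul_sum] at h
  have h2 : ∀ j, (Fintype.card G : ℂ)⁻¹ * ∑ g : G, c j * (irrep j).character g *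
      (irrep i).character g⁻¹ = if i = j then c j else 0 := by
    intro j
    simp only [mul_assoc]
    rw [← Finset.mul_sum, mul_left_comm, scalar_product_char, finrank_hom_irrep]
    split_ifs <;> simp
  simpa [h2, hi] using h

instance [Finite G] : Fintype (Irr G) := Fintype.ofFinite _

lemma char_eq_sum [Finite G] (V : FDRep ℂ G) (g : G) :
    V.character g = ∑ i : Irr G, (Module.finrank ℂ (irrep i ⟶ V) : ℂ) * (irrep i).character g := by
  classical
  induction V using rep_induction with
  | iso V W e ih =>
    have hc := FDRep.char_iso e
    rw [hc, ih]
    exact Finset.sum_congr rfl fun i _ => by rw [finrank_hom_congr rfl hc]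
  | zero V hV =>
    rw [char_zero hV]
    symm
    refine Finset.sum_eq_zero fun i _ => ?_
    have : Subsingleton (irrep i ⟶ V) := ⟨fun f g => hV.eq_of_tgt _ _⟩
    rw [Module.finrank_zero_of_subsingleton, Nat.cast_zero, zero_mul]
  | simple V hV =>
    obtain ⟨j, ⟨e⟩⟩ := exists_irrep V
    have hc := FDRep.char_iso e
    simp only [hc, finrank_hom_congr rfl hc, finrank_hom_irrep]
    simp
  | biprod V W hV hW =>
    simp only [char_biprod, hV, hW, finrank_hom_biprod_right, Nat.cast_add, add_mul,
      Finset.sum_add_distrib]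

/-- A regular representation on `Fin n`-indexed functions. -/
lemma exists_regular [Fintype G] [DecidableEq G] : ∃ R : FDRep ℂ G, ∀ g,
    R.character g = if g = 1 then (Fintype.card G : ℂ) else 0 := by
  -- The carrier has to lie in `Type`, while `G → ℂ` lies in `Type u`; hence the transport to `Fin`.
  let e : G ≃ Fin (Fintype.card G) := Fintype.equivFin G
  let ρ : Representation ℂ G (Fin (Fintype.card G) → ℂ) :=
    { toFun g := LinearMap.funLeft ℂ ℂ fun i => e (e.symm i * g)
      map_one' := by ext; simp
      map_mul' g h := by
        apply LinearMap.ext; intro v; ext i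
        simp [LinearMap.funLeft_apply, mul_assoc] }
  refine ⟨FDRep.of ρ, fun g => ?_⟩
  change LinearMap.trace ℂ (Fin (Fintype.card G) → ℂ) (ρ g) = _
  rw [LinearMap.trace_eq_matrix_trace ℂ (Pi.basisFun ℂ _), Matrix.trace]
  simp only [Matrix.diag, LinearMap.toMatrix_apply, Pi.basisFun_repr, Pi.basisFun_apply]
  have h : ∀ i, (ρ g) (Pi.single i 1) i = if g = 1 then (1 : ℂ) else 0 := by
    intro i
    change LinearMap.funLeft ℂ ℂ (fun i => e (e.symm i * g)) (Pi.single i 1) i = _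
    rw [LinearMap.funLeft_apply, Pi.single_apply]
    have : e (e.symm i * g) = i ↔ g = 1 := by
      rw [← e.eq_symm_apply]; simp
    simp only [this]
  simp only [h]
  split_ifs <;> simp

/-- The regular representation contains each irrep as often as its dimension. -/
lemma sum_dim_mul_char [Fintype G] [DecidableEq G] (g : G) :
    ∑ i : Irr G, (Module.finrank ℂ (irrep i) : ℂ) * (irrep i).character g =
      if g = 1 then (Fintype.card G : ℂ) else 0 := by
  obtain ⟨R, hR⟩ := exists_regular (G := G)
  rw [← hR, char_eq_sum]
  refine Finset.sum_congr rfl fun i _ => ?_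
  rw [← scalar_product_char]
  simp [hR]

/-- Column orthogonality. -/
lemma column_orthogonality [Fintype G] [DecidableEq G] (x y : G) :
    ∑ i : Irr G, (irrep i).character x * (irrep i).character y⁻¹ =
      ∑ g : G, if g * y = x * g then 1 else 0 := by
  -- By Schur, the average of the conjugates of y⁻¹ acts as a scalar, so the trace becomes a product
  -- of characters. Summed over i with weight the dimension, the left side is the regular character
  -- at x g y⁻¹ g⁻¹.
  have key : ∀ i : Irr G, ∑ g : G, (irrep i).character (x * (g * y⁻¹ * g⁻¹)) =
      (Fintype.card G : ℂ) / Module.finrank ℂ (irrep i) *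
        ((irrep i).character x * (irrep i).character y⁻¹) := by
    intro i
    simp only [FDRep.character, rho_mul]
    rw [← map_sum, ← Finset.mul_sum, sum_conj_eq, mul_smul_comm, mul_one, map_smul, smul_eq_mul]
    ring
  have hG : (Fintype.card G : ℂ) ≠ 0 := by simp
  have h1 : ∀ i : Irr G, (irrep i).character x * (irrep i).character y⁻¹ =
      (Fintype.card G : ℂ)⁻¹ * ∑ g : G, (Module.finrank ℂ (irrep i) : ℂ) *
        (irrep i).character (x * (g * y⁻¹ * g⁻¹)) := by
    intro i
    have hD : (Module.finrank ℂ (irrep i) : ℂ) ≠ 0 := by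
      exact_mod_cast (finrank_pos_of_simple (irrep i)).ne'
    rw [← Finset.mul_sum, key]
    field_simp
  rw [Finset.sum_congr rfl fun i _ => h1 i, ← Finset.mul_sum, Finset.sum_comm]
  simp only [sum_dim_mul_char, Finset.mul_sum, mul_ite, mul_zero, inv_mul_cancel₀ hG]
  refine Finset.sum_congr rfl fun g _ => ?_
  congr 1
  rw [← mul_assoc, mul_inv_eq_one, ← mul_assoc, mul_inv_eq_iff_eq_mul]
  exact propext eq_comm

end
end TensorRank

namespace TensorRank
noncomputable section
universe u
variable {G : Type u} [Group G]

/-! ### Multiplicities of linear characters of a subgroup -/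

section Eigenspaces

variable {K : Type*} [Group K] (φ : K →* G) (χ : K →* ℂ)

/-- The vectors on which `K` acts through the character `χ`. -/
def eigenvectors (V : FDRep ℂ G) : Submodule ℂ V where
  carrier := {v | ∀ k, V.ρ (φ k) v = χ k • v}
  zero_mem' := by simp
  add_mem' hv hw k := by rw [map_add, hv k, hw k, smul_add]
  smul_mem' c v hv k := by rw [map_smul, hv k, smul_comm]

lemma mem_eigenvectors {V : FDRep ℂ G} {v : V} :
    v ∈ eigenvectors φ χ V ↔ ∀ k, V.ρ (φ k) v = χ k • v := Iff.rfl

/-- The multiplicity of the character `χ` in the restriction of `V` to `K`. -/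
def charMult (V : FDRep ℂ G) : ℕ := Module.finrank ℂ (eigenvectors φ χ V)

/-- The eigenvectors are the invariants of the restriction twisted by χ⁻¹. -/
lemma charMult_eq [Fintype K] (V : FDRep ℂ G) :
    (charMult φ χ V : ℂ) = (Fintype.card K : ℂ)⁻¹ * ∑ k, χ k⁻¹ * V.character (φ k) := by
  have hu (k : K) : χ k⁻¹ * χ k = 1 := by rw [← map_mul, inv_mul_cancel, map_one]
  have hu' (k : K) : χ k * χ k⁻¹ = 1 := by rw [← map_mul, mul_inv_cancel, map_one]
  let ρ : Representation ℂ K V :=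
    { toFun k := χ k⁻¹ • V.ρ (φ k)
      map_one' := by simp
      map_mul' a b := by
        rw [map_mul, map_mul, smul_mul_smul_comm, mul_inv_rev, map_mul, mul_comm] }
  have := invertibleOfNonzero (NeZero.ne (Nat.card K : ℂ))
  have h := Representation.card_inv_mul_sum_char_eq_finrank ρ
  have hi : eigenvectors φ χ V = ρ.invariants := by
    ext v
    rw [mem_eigenvectors, Representation.mem_invariants]
    refine forall_congr' fun k => ?_
    change _ ↔ χ k⁻¹ • V.ρ (φ k) v = v
    constructor
    · intro h; rw [h, smul_smul, hu, one_smul]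
    · intro h
      conv_rhs => rw [← h]
      rw [smul_smul, hu', one_smul]
  rw [charMult, hi, ← h, Nat.card_eq_fintype_card]
  congr 1
  refine Finset.sum_congr rfl fun k _ => ?_
  change LinearMap.trace ℂ V (χ k⁻¹ • V.ρ (φ k)) = _
  rw [map_smul, smul_eq_mul]
  rfl

lemma charMult_pos_iff (V : FDRep ℂ G) :
    0 < charMult φ χ V ↔ ∃ v : V, v ≠ 0 ∧ ∀ k, V.ρ (φ k) v = χ k • v := by
  rw [charMult, Module.finrank_pos_iff_exists_ne_zero]
  constructor
  · rintro ⟨⟨v, hv⟩, h0⟩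
    exact ⟨v, fun h => h0 (Subtype.ext h), hv⟩
  · rintro ⟨v, h0, hv⟩
    exact ⟨⟨v, hv⟩, fun h => h0 (congrArg Subtype.val h)⟩

lemma charMult_congr [Finite K] {V W : FDRep ℂ G} (h : V.character = W.character) :
    charMult φ χ V = charMult φ χ W := by
  have := Fintype.ofFinite K
  have h1 := charMult_eq φ χ V
  rw [h, ← charMult_eq] at h1
  exact_mod_cast h1

lemma charMult_eq_sum [Finite K] [Finite G] (V : FDRep ℂ G) :
    charMult φ χ V = ∑ i : Irr G, Module.finrank ℂ (irrep i ⟶ V) * charMult φ χ (irrep i) := by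
  have := Fintype.ofFinite K
  have : (charMult φ χ V : ℂ) =
      ∑ i : Irr G, (Module.finrank ℂ (irrep i ⟶ V) : ℂ) * charMult φ χ (irrep i) := by
    simp only [charMult_eq, char_eq_sum V, Finset.mul_sum]
    rw [Finset.sum_comm]
    refine Finset.sum_congr rfl fun i _ => Finset.sum_congr rfl fun k _ => ?_
    ring
  exact_mod_cast this

/-- The pure tensor of two eigenvectors is an eigenvector; it is nonzero because a product of linear
functionals detects it. -/
lemma charMult_tensor_pos (χ₁ χ₂ : K →* ℂ) {V W : FDRep ℂ G} (hV : 0 < charMult φ χ₁ V)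
    (hW : 0 < charMult φ χ₂ W) : 0 < charMult φ (χ₁ * χ₂) (V ⊗ W) := by
  rw [charMult_pos_iff] at *
  obtain ⟨v, hv0, hv⟩ := hV
  obtain ⟨w, hw0, hw⟩ := hW
  refine ⟨(v ⊗ₜ[ℂ] w : TensorProduct ℂ V W), ?_, fun k => ?_⟩
  · intro h
    obtain ⟨f, hf⟩ := not_forall.1 (mt (Module.forall_dual_apply_eq_zero_iff ℂ v).1 hv0)
    obtain ⟨g, hg⟩ := not_forall.1 (mt (Module.forall_dual_apply_eq_zero_iff ℂ w).1 hw0)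
    have h1 : LinearMap.mul' ℂ ℂ (TensorProduct.map f g (v ⊗ₜ[ℂ] w)) =
      LinearMap.mul' ℂ ℂ (TensorProduct.map f g 0) := congrArg _ (congrArg _ h)
    rw [TensorProduct.map_tmul, LinearMap.mul'_apply, map_zero, map_zero] at h1
    exact (mul_ne_zero hf hg) h1
  · change TensorProduct.map (V.ρ (φ k)) (W.ρ (φ k)) (v ⊗ₜ[ℂ] w) = _
    rw [TensorProduct.map_tmul, hv, hw, TensorProduct.smul_tmul_smul]
    rfl

end Eigenspaces

/-! ### Characters on the representation ring -/

section Ring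

/-- The character of a class in the representation ring. -/
def skeletonChar (G : Type u) [Group G] : Skeleton (FDRep ℂ G) →* (G → ℂ) where
  toFun s := ((fromSkeleton (FDRep ℂ G)).obj s).character
  map_one' := by
    rw [Skeleton.one_eq, FDRep.char_iso (fromSkeletonToSkeletonIso (𝟙_ (FDRep ℂ G)))]
    ext g
    exact LinearMap.trace_id ℂ ℂ |>.trans (by simp)
  map_mul' s t := by
    rw [← toSkeleton_fromSkeleton_obj s, ← toSkeleton_fromSkeleton_obj t,
      ← Skeleton.toSkeleton_tensorObj, FDRep.char_iso (fromSkeletonToSkeletonIso _),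
      FDRep.char_tensor, FDRep.char_iso (fromSkeletonToSkeletonIso _),
      FDRep.char_iso (fromSkeletonToSkeletonIso _)]

def freeChar (G : Type u) [Group G] : FreeRepRing G →+* (G → ℂ) :=
  (MonoidAlgebra.lift ℤ (G → ℂ) (Skeleton (FDRep ℂ G)) (skeletonChar G)).toRingHom

lemma freeChar_freeClass (V : FDRep ℂ G) : freeChar G (freeClass V) = V.character := by
  have : freeChar G (freeClass V) = skeletonChar G (toSkeleton V) := by
    change MonoidAlgebra.lift ℤ (G → ℂ) (Skeleton (FDRep ℂ G)) (skeletonChar G)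
      (MonoidAlgebra.of ℤ _ _) = _
    rw [MonoidAlgebra.lift_of]
  rw [this]
  exact FDRep.char_iso (fromSkeletonToSkeletonIso V)

/-- The character homomorphism on the representation ring. -/
def repRingChar (G : Type u) [Group G] : RepRing G →+* (G → ℂ) :=
  Ideal.Quotient.lift (directSumIdeal G) (freeChar G) (by
    intro a ha
    have h : directSumIdeal G ≤ RingHom.ker (freeChar G) := by
      refine Ideal.span_le.2 ?_
      rintro _ ⟨V, W, rfl⟩
      rw [SetLike.mem_coe, RingHom.mem_ker, map_sub, map_add, freeChar_freeClass,
        freeChar_freeClass, freeChar_freeClass, sub_eq_zero]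
      ext g
      exact char_biprod V W g
    exact (RingHom.mem_ker (f := freeChar G)).1 (h ha))

lemma repRingChar_repClass (V : FDRep ℂ G) : repRingChar G (repClass V) = V.character := by
  exact (Ideal.Quotient.lift_mk _ _ _).trans (freeChar_freeClass V)

lemma repClass_iso {V W : FDRep ℂ G} (e : V ≅ W) : repClass V = repClass W := by
  rw [repClass, freeClass, congr_toSkeleton_of_iso e]; rfl

lemma repClass_biprod (V W : FDRep ℂ G) : repClass (V ⊞ W) = repClass V + repClass W := by
  rw [repClass, repClass, repClass, ← map_add, Ideal.Quotient.eq]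
  exact Ideal.subset_span ⟨V, W, rfl⟩

lemma repClass_zero {V : FDRep ℂ G} (h : IsZero V) : repClass V = 0 := by
  have hz : IsZero (V ⊞ V) := (biprod_isZero_iff V V).2 ⟨h, h⟩
  have := repClass_biprod V V
  rw [repClass_iso (hz.iso h)] at this
  simpa using this

lemma closure_repClass_eq_top [Finite G] :
    AddSubgroup.closure {x : RepRing G | ∃ V : FDRep ℂ G, Simple V ∧ x = repClass V} = ⊤ := by
  set S := AddSubgroup.closure {x : RepRing G | ∃ V : FDRep ℂ G, Simple V ∧ x = repClass V}
  have h1 (V : FDRep ℂ G) : repClass V ∈ S := by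
    induction V using rep_induction with
    | iso V W e ih => rwa [repClass_iso e]
    | zero V hV => rw [repClass_zero hV]; exact S.zero_mem
    | simple V hV => exact AddSubgroup.subset_closure ⟨V, hV, rfl⟩
    | biprod V W hV hW => rw [repClass_biprod]; exact S.add_mem hV hW
  rw [eq_top_iff]
  rintro x -
  obtain ⟨y, rfl⟩ := Ideal.Quotient.mk_surjective x
  induction y using MonoidAlgebra.induction_on with
  | of s =>
    have := h1 ((fromSkeleton _).obj s)
    rwa [repClass, freeClass, toSkeleton_fromSkeleton_obj] at this
  | add a b ha hb => rw [map_add]; exact S.add_mem ha hb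
  | smul r a ha => rw [map_zsmul]; exact S.zsmul_mem ha r

/-- Pairing with the character of V is additive on R(G), equals 1 on V, and vanishes on every irrep
not isomorphic to V; so V cannot lie in a span of other irreps. -/
lemma exists_iso_of_repClass_mem_closure [Finite G] {P : FDRep ℂ G → Prop}
    (hP : ∀ W, P W → Simple W) {V : FDRep ℂ G} [Simple V]
    (h : repClass V ∈ AddSubgroup.closure {x | ∃ W, P W ∧ x = repClass W}) :
    ∃ W, P W ∧ Nonempty (V ≅ W) := by
  classical
  have := Fintype.ofFinite G
  by_contra! H
  let L : RepRing G →+ ℂ :=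
    { toFun x := (Fintype.card G : ℂ)⁻¹ * ∑ g : G, repRingChar G x g * V.character g⁻¹
      map_zero' := by simp
      map_add' x y := by
        simp only [map_add, Pi.add_apply, add_mul, Finset.sum_add_distrib, mul_add] }
  have hL (W : FDRep ℂ G) : L (repClass W) = Module.finrank ℂ (V ⟶ W) := by
    change (Fintype.card G : ℂ)⁻¹ * ∑ g : G, repRingChar G (repClass W) g * V.character g⁻¹ = _
    rw [repRingChar_repClass, scalar_product_char]
  have h0 : AddSubgroup.closure {x | ∃ W, P W ∧ x = repClass W} ≤ L.ker := by
    rw [AddSubgroup.closure_le]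
    rintro _ ⟨W, hW, rfl⟩
    have := hP W hW
    rw [SetLike.mem_coe, AddMonoidHom.mem_ker, hL, FDRep.finrank_hom_simple_simple, if_neg]
    · simp
    · rw [not_nonempty_iff]; exact H W hW
  have h1 := h0 h
  rw [AddMonoidHom.mem_ker, hL, FDRep.finrank_hom_simple_simple, if_pos ⟨Iso.refl V⟩] at h1
  simp at h1

end Ring

end
end TensorRank

namespace TensorRank
noncomputable section
universe u
-- Intertwining numbers of induced characters
section Mackey
variable {G : Type u} [Group G] [Fintype G] [DecidableEq G] {K : Type*} [Group K] [Fintype K]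
  (φ : K →* G) (χ : K →* ℂ)

omit [Fintype G] [DecidableEq G] in
lemma charMult_eq_inv (V : FDRep ℂ G) :
    (charMult φ χ V : ℂ) = (Fintype.card K : ℂ)⁻¹ * ∑ k, χ k * V.character (φ k)⁻¹ := by
  rw [charMult_eq, ← Equiv.sum_comp (Equiv.inv K)]
  simp

/-- By Frobenius reciprocity the left side is the intertwining number of the representations induced
from χ and χ'. Column orthogonality turns it into Mackey's sum over solutions of g φ(l) g⁻¹ = φ(k).
-/
lemma sum_charMult_mul_charMult (χ' : K →* ℂ) :
    ∑ i : Irr G, (charMult φ χ (irrep i) : ℂ) * charMult φ χ' (irrep i) =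
      ((Fintype.card K : ℂ) ^ 2)⁻¹ * ∑ g : G, ∑ k, ∑ l,
        if g * φ l = φ k * g then χ k⁻¹ * χ' l else 0 := by
  have h : ∀ i : Irr G, (charMult φ χ (irrep i) : ℂ) * charMult φ χ' (irrep i) =
      ((Fintype.card K : ℂ) ^ 2)⁻¹ * ∑ k, ∑ l, χ k⁻¹ * χ' l *
        ((irrep i).character (φ k) * (irrep i).character (φ l)⁻¹) := by
    intro i
    rw [charMult_eq φ χ, charMult_eq_inv φ χ', mul_mul_mul_comm, Finset.sum_mul_sum, ← mul_inv,
      sq]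
    congr 1
    refine Finset.sum_congr rfl fun k _ => Finset.sum_congr rfl fun l _ => ?_
    ring
  rw [Finset.sum_congr rfl fun i _ => h i, ← Finset.mul_sum, Finset.sum_comm]
  congr 1
  rw [Finset.sum_comm (s := Finset.univ (α := G))]
  refine Finset.sum_congr rfl fun k _ => ?_
  rw [Finset.sum_comm, Finset.sum_comm (s := Finset.univ (α := G))]
  refine Finset.sum_congr rfl fun l _ => ?_
  rw [← Finset.mul_sum, column_orthogonality, Finset.mul_sum]
  simp

/-- This is the degree of the induced representation, the index of K. -/
lemma sum_charMult_mul_finrank (hφ : Function.Injective φ) :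
    ∑ i : Irr G, (charMult φ χ (irrep i) : ℂ) * Module.finrank ℂ (irrep i) =
      (Fintype.card K : ℂ)⁻¹ * Fintype.card G := by
  have h : ∀ i : Irr G, (charMult φ χ (irrep i) : ℂ) * Module.finrank ℂ (irrep i) =
      (Fintype.card K : ℂ)⁻¹ * ∑ k, χ k⁻¹ *
        ((irrep i).character (φ k) * (irrep i).character 1⁻¹) := by
    intro i
    rw [charMult_eq φ χ, inv_one, FDRep.char_one, mul_assoc, Finset.sum_mul]
    simp only [mul_assoc]
  rw [Finset.sum_congr rfl fun i _ => h i, ← Finset.mul_sum, Finset.sum_comm]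
  congr 1
  simp only [← Finset.mul_sum, column_orthogonality, mul_one]
  have h1 (k : K) (g : G) : g = φ k * g ↔ k = 1 := by
    rw [← map_eq_one_iff φ hφ, right_eq_mul]
  classical
  have h2 (k : K) : (∑ g : G, if g = φ k * g then (1 : ℂ) else 0) =
      if k = 1 then (Fintype.card G : ℂ) else 0 := by
    split_ifs with hk
    · simp [hk]
    · exact Finset.sum_eq_zero fun g _ => if_neg fun h => hk ((h1 k g).1 h)
  rw [Finset.sum_congr rfl fun k _ => congrArg (χ k⁻¹ * ·) (h2 k)]
  simp

end Mackey

/-! ### Unipotent and Borel subgroups, Bruhat decomposition -/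

section SL2

variable {F : Type u} [Field F]

/-- The upper unitriangular matrices. -/
def unip : Multiplicative F →* SL2 F where
  toFun x := ⟨!![1, x.toAdd; 0, 1], by simp [Matrix.det_fin_two]⟩
  map_one' := by ext i j; fin_cases i <;> fin_cases j <;> simp
  map_mul' x y := by
    apply Subtype.ext
    change _ = !![1, x.toAdd; 0, 1] * !![1, y.toAdd; 0, 1]
    simp [add_comm]

/-- The upper triangular matrix with diagonal `t, t⁻¹` and upper right entry `x`. -/
def upper (t : Fˣ) (x : F) : SL2 F :=
  ⟨!![(t : F), x; 0, ((t⁻¹ : Fˣ) : F)], by simp [Matrix.det_fin_two]⟩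

/-- The element of the big Bruhat cell with given diagonal and lower left entry. -/
def bigCell (c : Fˣ) (a d : F) : SL2 F :=
  ⟨!![a, (a * d - 1) * ((c⁻¹ : Fˣ) : F); (c : F), d], by
    simp [Matrix.det_fin_two]⟩

@[simp] lemma unip_apply_00 (x : Multiplicative F) : (unip x).1 0 0 = 1 := rfl
@[simp] lemma unip_apply_01 (x : Multiplicative F) : (unip x).1 0 1 = x.toAdd := rfl
@[simp] lemma unip_apply_10 (x : Multiplicative F) : (unip x).1 1 0 = 0 := rfl
@[simp] lemma unip_apply_11 (x : Multiplicative F) : (unip x).1 1 1 = 1 := rfl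
@[simp] lemma upper_apply_00 (t : Fˣ) (x : F) : (upper t x).1 0 0 = (t : F) := rfl
@[simp] lemma upper_apply_01 (t : Fˣ) (x : F) : (upper t x).1 0 1 = x := rfl
@[simp] lemma upper_apply_10 (t : Fˣ) (x : F) : (upper t x).1 1 0 = 0 := rfl
@[simp] lemma upper_apply_11 (t : Fˣ) (x : F) : (upper t x).1 1 1 = ((t⁻¹ : Fˣ) : F) := rfl
@[simp] lemma bigCell_apply_00 (c : Fˣ) (a d : F) : (bigCell c a d).1 0 0 = a := rfl
@[simp] lemma bigCell_apply_01 (c : Fˣ) (a d : F) :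
    (bigCell c a d).1 0 1 = (a * d - 1) * ((c⁻¹ : Fˣ) : F) := rfl
@[simp] lemma bigCell_apply_10 (c : Fˣ) (a d : F) : (bigCell c a d).1 1 0 = (c : F) := rfl
@[simp] lemma bigCell_apply_11 (c : Fˣ) (a d : F) : (bigCell c a d).1 1 1 = d := rfl

lemma SL2_ext_iff {g h : SL2 F} : g = h ↔ g.1 0 0 = h.1 0 0 ∧ g.1 0 1 = h.1 0 1 ∧
    g.1 1 0 = h.1 1 0 ∧ g.1 1 1 = h.1 1 1 := by
  constructor
  · rintro rfl; simp
  · rintro ⟨h1, h2, h3, h4⟩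
    apply Subtype.ext
    ext i j; fin_cases i <;> fin_cases j <;> assumption

lemma SL2_mul_apply (g h : SL2 F) (i j : Fin 2) :
    (g * h).1 i j = g.1 i 0 * h.1 0 j + g.1 i 1 * h.1 1 j := by
  change (g.1 * h.1) i j = _
  rw [Matrix.mul_apply, Fin.sum_univ_two]

lemma SL2_det (g : SL2 F) : g.1 0 0 * g.1 1 1 - g.1 0 1 * g.1 1 0 = 1 := by
  rw [← Matrix.det_fin_two]; exact g.2

/-- The Bruhat decomposition. -/
lemma sum_bruhat [Fintype F] [DecidableEq F] (f : SL2 F → ℂ) :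
    ∑ g, f g = ∑ t : Fˣ, ∑ x : F, f (upper t x) +
      ∑ c : Fˣ, ∑ a : F, ∑ d : F, f (bigCell c a d) := by
  let e : (Fˣ × F) ⊕ (Fˣ × F × F) → SL2 F :=
    Sum.elim (fun p => upper p.1 p.2) (fun p => bigCell p.1 p.2.1 p.2.2)
  have he : Function.Bijective e := by
    constructor
    · rintro (⟨t, x⟩ | ⟨c, a, d⟩) (⟨t', x'⟩ | ⟨c', a', d'⟩) h
      · change upper t x = upper t' x' at h
        rw [SL2_ext_iff] at h
        simp only [upper_apply_00, upper_apply_01, Units.val_inj] at h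
        rw [h.1, h.2.1]
      · change upper t x = bigCell c' a' d' at h
        rw [SL2_ext_iff] at h
        exact absurd h.2.2.1.symm c'.ne_zero
      · change bigCell c a d = upper t' x' at h
        rw [SL2_ext_iff] at h
        exact absurd h.2.2.1 c.ne_zero
      · change bigCell c a d = bigCell c' a' d' at h
        rw [SL2_ext_iff] at h
        simp only [bigCell_apply_00, bigCell_apply_10, bigCell_apply_11, Units.val_inj] at h
        rw [h.1, h.2.2.1, h.2.2.2]
    · intro g
      have hdet := SL2_det g
      by_cases hc : g.1 1 0 = 0
      · rw [hc, mul_zero, sub_zero] at hdet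
        refine ⟨.inl (Units.mkOfMulEqOne _ _ hdet, g.1 0 1), ?_⟩
        change upper _ _ = _
        rw [SL2_ext_iff]
        exact ⟨rfl, rfl, hc.symm, rfl⟩
      · refine ⟨.inr (Units.mk0 _ hc, g.1 0 0, g.1 1 1), ?_⟩
        change bigCell _ _ _ = _
        rw [SL2_ext_iff]
        refine ⟨rfl, ?_, rfl, rfl⟩
        simp only [bigCell_apply_01, Units.val_inv_eq_inv_val, Units.val_mk0]
        field_simp
        linear_combination hdet
  rw [← Equiv.sum_comp (Equiv.ofBijective e he), Fintype.sum_sum_type]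
  simp [Fintype.sum_prod_type, e]

lemma card_SL2 [Fintype F] [DecidableEq F] : (Fintype.card (SL2 F) : ℂ) =
    Fintype.card F * (Fintype.card F - 1) * (Fintype.card F + 1) := by
  have h := sum_bruhat (F := F) (fun _ => 1)
  have hu : (Fintype.card Fˣ : ℂ) = Fintype.card F - 1 := by
    rw [Fintype.card_units, Nat.cast_sub Fintype.card_pos, Nat.cast_one]
  simp only [Finset.sum_const, Finset.card_univ, nsmul_eq_mul, mul_one, hu] at h
  rw [h]
  ring

/-- The upper triangular matrices. -/
def borel (F : Type u) [Field F] : Subgroup (SL2 F) where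
  carrier := {g | g.1 1 0 = 0}
  one_mem' := by simp
  mul_mem' {g h} hg hh := by
    simp only [Set.mem_ofPred_eq] at *
    rw [SL2_mul_apply, hg, hh]; ring
  inv_mem' {g} hg := by
    simp only [Set.mem_ofPred_eq] at *
    simp [Matrix.SpecialLinearGroup.coe_inv, Matrix.adjugate_fin_two, hg]

lemma borel_det (g : borel F) : g.1.1 0 0 * g.1.1 1 1 = 1 := by
  have h1 := SL2_det g.1
  have h2 : g.1.1 1 0 = 0 := g.2
  rw [h2] at h1
  simpa using h1

/-- The upper left entry of an upper triangular matrix. -/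
def borelDiag : borel F →* Fˣ where
  toFun g := Units.mkOfMulEqOne _ _ (borel_det g)
  map_one' := by ext; simp
  map_mul' g h := by
    have hh : h.1.1 1 0 = 0 := h.2
    ext
    change (g.1 * h.1).1 0 0 = g.1.1 0 0 * h.1.1 0 0
    rw [SL2_mul_apply, hh]; ring

def borelEquiv : Fˣ × F ≃ borel F where
  toFun p := ⟨upper p.1 p.2, upper_apply_10 _ _⟩
  invFun g := (borelDiag g, g.1.1 0 1)
  left_inv p := by
    apply Prod.ext
    · apply Units.ext; rfl
    · rfl
  right_inv g := by
    apply Subtype.ext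
    rw [SL2_ext_iff]
    exact ⟨rfl, rfl, g.2.symm, rfl⟩

instance [Fintype F] [DecidableEq F] : Fintype (borel F) := Fintype.ofEquiv _ borelEquiv

lemma borelDiag_upper (t : Fˣ) (x : F) : borelDiag (borelEquiv (t, x)) = t :=
  Units.ext rfl

lemma borel_subtype_upper (t : Fˣ) (x : F) :
    (borel F).subtype (borelEquiv (t, x)) = upper t x := rfl

lemma card_borel [Fintype F] [DecidableEq F] : (Fintype.card (borel F) : ℂ) =
    Fintype.card F * (Fintype.card F - 1) := by
  have hu : (Fintype.card Fˣ : ℂ) = Fintype.card F - 1 := by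
    rw [Fintype.card_units, Nat.cast_sub Fintype.card_pos, Nat.cast_one]
  rw [← Fintype.card_congr borelEquiv, Fintype.card_prod, Nat.cast_mul, hu, mul_comm]

/-- The multiplicity of the unipotent character `x ↦ ψ (a x)` in `V`. -/
def unipMult (ψ : AddChar F ℂ) (a : F) (V : FDRep ℂ (SL2 F)) : ℕ :=
  charMult unip (AddChar.mulShift ψ a).toMonoidHom V

/-- The multiplicity in `V` of a character of the diagonal torus, extended to `borel F`. -/
def borelMult (χ : Fˣ →* ℂ) (V : FDRep ℂ (SL2 F)) : ℕ :=
  charMult (borel F).subtype (χ.comp borelDiag) V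

end SL2

end
end TensorRank

/-! ### Mackey sums for the unipotent and Borel subgroups -/

namespace TensorRank
noncomputable section
universe u
variable {F : Type u} [Field F]

/-- This and the next three equivalences solve the Mackey equation on each Bruhat cell. -/
lemma upper_mul_unip_iff (t : Fˣ) (z x y : F) :
    upper t z * unip (.ofAdd y) = unip (.ofAdd x) * upper t z ↔ x = t ^ 2 * y := by
  have ht : (t : F) ≠ 0 := t.ne_zero
  simp only [SL2_ext_iff, SL2_mul_apply, upper_apply_00, upper_apply_01, upper_apply_10,
    upper_apply_11, unip_apply_00, unip_apply_01, unip_apply_10, unip_apply_11, toAdd_ofAdd,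
    Units.val_inv_eq_inv_val]
  constructor
  · rintro ⟨-, h, -, -⟩
    field_simp at h
    linear_combination -h
  · rintro rfl
    refine ⟨by ring, by field_simp; ring, by ring, by ring⟩

lemma bigCell_mul_unip_iff (c : Fˣ) (a d x y : F) :
    bigCell c a d * unip (.ofAdd y) = unip (.ofAdd x) * bigCell c a d ↔ x = 0 ∧ y = 0 := by
  have hc : (c : F) ≠ 0 := c.ne_zero
  simp only [SL2_ext_iff, SL2_mul_apply, bigCell_apply_00, bigCell_apply_01, bigCell_apply_10,
    bigCell_apply_11, unip_apply_00, unip_apply_01, unip_apply_10, unip_apply_11, toAdd_ofAdd,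
    Units.val_inv_eq_inv_val]
  constructor
  · rintro ⟨h1, -, -, h2⟩
    constructor
    · refine (mul_eq_zero_iff_right hc).1 ?_
      linear_combination -h1
    · refine (mul_eq_zero_iff_left hc).1 ?_
      linear_combination h2
  · rintro ⟨rfl, rfl⟩
    refine ⟨by ring, by ring, by ring, by ring⟩

lemma upper_mul_upper_iff (r s t : Fˣ) (z x y : F) :
    upper r z * upper s y = upper t x * upper r z ↔
      s = t ∧ x = r * (r * y + z * (s : F)⁻¹ - t * z) := by
  have hr : (r : F) ≠ 0 := r.ne_zero
  have hs : (s : F) ≠ 0 := s.ne_zero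
  simp only [SL2_ext_iff, SL2_mul_apply, upper_apply_00, upper_apply_01, upper_apply_10,
    upper_apply_11, Units.val_inv_eq_inv_val]
  constructor
  · rintro ⟨h1, h2, -, -⟩
    have hst : s = t := Units.ext (mul_left_cancel₀ hr (by linear_combination h1))
    refine ⟨hst, ?_⟩
    field_simp at h2 ⊢
    linear_combination -h2
  · rintro ⟨rfl, rfl⟩
    refine ⟨by ring, by field_simp; ring, by ring, by ring⟩

lemma bigCell_mul_upper_iff (c s t : Fˣ) (a d x y : F) :
    bigCell c a d * upper s y = upper t x * bigCell c a d ↔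
      s = t⁻¹ ∧ x = a * ((t : F)⁻¹ - t) * (c : F)⁻¹ ∧ y = d * ((t : F)⁻¹ - t) * (c : F)⁻¹ := by
  have hc : (c : F) ≠ 0 := c.ne_zero
  have hs : (s : F) ≠ 0 := s.ne_zero
  have ht : (t : F) ≠ 0 := t.ne_zero
  simp only [SL2_ext_iff, SL2_mul_apply, bigCell_apply_00, bigCell_apply_01, bigCell_apply_10,
    bigCell_apply_11, upper_apply_00, upper_apply_01, upper_apply_10,
    upper_apply_11, Units.val_inv_eq_inv_val]
  constructor
  · rintro ⟨h1, -, h3, h4⟩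
    have hst : s = t⁻¹ := by
      apply Units.ext
      rw [Units.val_inv_eq_inv_val]
      exact mul_left_cancel₀ hc (by linear_combination h3)
    subst hst
    simp only [Units.val_inv_eq_inv_val, inv_inv] at h1 h4
    refine ⟨rfl, ?_, ?_⟩
    · rw [eq_mul_inv_iff_mul_eq₀ hc]; linear_combination -h1
    · rw [eq_mul_inv_iff_mul_eq₀ hc]; linear_combination h4
  · rintro ⟨rfl, rfl, rfl⟩
    simp only [Units.val_inv_eq_inv_val, inv_inv]
    refine ⟨by field_simp; ring, by field_simp; ring, by field_simp; ring, by field_simp; ring⟩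

variable [Fintype F] [DecidableEq F]

lemma card_units_cast : (Fintype.card Fˣ : ℂ) = Fintype.card F - 1 := by
  rw [Fintype.card_units, Nat.cast_sub Fintype.card_pos, Nat.cast_one]

omit [DecidableEq F] in
lemma card_units_ne_zero : (Fintype.card F : ℂ) - 1 ≠ 0 := by
  classical
  rw [← card_units_cast]
  simp

omit [DecidableEq F] in
lemma unipMult_eq (ψ : AddChar F ℂ) (a : F) (V : FDRep ℂ (SL2 F)) :
    (unipMult ψ a V : ℂ) =
      (Fintype.card F : ℂ)⁻¹ * ∑ x : F, ψ (-(a * x)) * V.character (unip (.ofAdd x)) := by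
  rw [unipMult, charMult_eq, Fintype.card_multiplicative, ← Equiv.sum_comp Multiplicative.ofAdd]
  congr 1
  refine Finset.sum_congr rfl fun x _ => ?_
  congr 1
  change ψ (a * -x) = _
  rw [mul_neg]

lemma borelMult_eq (χ : Fˣ →* ℂ) (V : FDRep ℂ (SL2 F)) :
    (borelMult χ V : ℂ) = ((Fintype.card F : ℂ) * (Fintype.card F - 1))⁻¹ *
      ∑ t : Fˣ, ∑ x : F, χ t⁻¹ * V.character (upper t x) := by
  rw [borelMult, charMult_eq, card_borel, ← Equiv.sum_comp borelEquiv, Fintype.sum_prod_type]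
  congr 1
  refine Finset.sum_congr rfl fun t _ => Finset.sum_congr rfl fun x _ => ?_
  rw [borel_subtype_upper, MonoidHom.comp_apply, map_inv, borelDiag_upper]

/-- On the big cell only x = y = 0 contributes, which gives q - 1. On the Borel cell the sum of
ψ(y(b - at²)) over y vanishes unless at² = b. -/
lemma sum_unipMult_mul {ψ : AddChar F ℂ} (hψ : ψ.IsPrimitive) (a b : F) :
    ∑ i : Irr (SL2 F), (unipMult ψ a (irrep i) : ℂ) * unipMult ψ b (irrep i) =
      (Fintype.card F - 1) + ∑ t : Fˣ, if a * t ^ 2 = b then (1 : ℂ) else 0 := by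
  have hq : (Fintype.card F : ℂ) ≠ 0 := by simp
  simp only [unipMult]
  rw [sum_charMult_mul_charMult, sum_bruhat, Fintype.card_multiplicative]
  simp only [← Equiv.sum_comp (Multiplicative.ofAdd (α := F))]
  simp only [upper_mul_unip_iff, bigCell_mul_unip_iff]
  have h1 (t : Fˣ) : ∑ x : F, ∑ y : F, (if x = t ^ 2 * y then
      (AddChar.mulShift ψ a).toMonoidHom (Multiplicative.ofAdd x)⁻¹ *
        (AddChar.mulShift ψ b).toMonoidHom (Multiplicative.ofAdd y) else 0) =
      if a * t ^ 2 = b then (Fintype.card F : ℂ) else 0 := by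
    rw [Finset.sum_comm]
    have h2 (y : F) : ∑ x : F, (if x = t ^ 2 * y then
      (AddChar.mulShift ψ a).toMonoidHom (Multiplicative.ofAdd x)⁻¹ *
        (AddChar.mulShift ψ b).toMonoidHom (Multiplicative.ofAdd y) else 0) =
        ψ (y * (b - a * t ^ 2)) := by
      rw [Finset.sum_ite_eq' Finset.univ, if_pos (Finset.mem_univ _)]
      change ψ (a * -(t ^ 2 * y)) * ψ (b * y) = _
      rw [← AddChar.map_add_eq_mul]
      congr 1; ring
    simp only [h2]
    rw [AddChar.sum_mulShift _ hψ]
    simp only [sub_eq_zero, eq_comm (a := b)]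
    split_ifs <;> simp
  have h3 : ∑ x : F, ∑ y : F, (if x = 0 ∧ y = 0 then
      (AddChar.mulShift ψ a).toMonoidHom (Multiplicative.ofAdd x)⁻¹ *
        (AddChar.mulShift ψ b).toMonoidHom (Multiplicative.ofAdd y) else 0) = 1 := by
    rw [Finset.sum_eq_single 0, Finset.sum_eq_single 0]
    · simp
    · intro y _ hy; simp [hy]
    · simp
    · intro x _ hx; simp [hx]
    · simp
  simp only [h1, h3, Finset.sum_const, Finset.card_univ, nsmul_eq_mul, mul_one, card_units_cast]
  rw [← Finset.mul_sum]
  have h4 : (∑ t : Fˣ, if a * t ^ 2 = b then (Fintype.card F : ℂ) else 0) =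
      Fintype.card F * ∑ t : Fˣ, if a * t ^ 2 = b then (1 : ℂ) else 0 := by
    rw [Finset.mul_sum]; simp
  rw [h4]
  field_simp
  ring

lemma sum_char_units (χ : Fˣ →* ℂ) [Decidable (χ = 1)] :
    ∑ t : Fˣ, χ t = if χ = 1 then (Fintype.card F : ℂ) - 1 else 0 := by
  split_ifs with h
  · simp [h, card_units_cast]
  · obtain ⟨s, hs⟩ : ∃ s, χ s ≠ 1 := by
      by_contra! H
      exact h (MonoidHom.ext H)
    have h1 : χ s * ∑ t : Fˣ, χ t = ∑ t : Fˣ, χ t := by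
      rw [Finset.mul_sum, ← Equiv.sum_comp (Equiv.mulLeft s) (fun t => χ t)]
      simp
    have h2 : (χ s - 1) * ∑ t : Fˣ, χ t = 0 := by linear_combination h1
    exact (mul_eq_zero.1 h2).resolve_left (sub_ne_zero.2 hs)

-- The Borel cell contributes the case χ = χ'; on the big cell the Weyl element inverts the torus,
-- which contributes χχ' = 1.
open Classical in
lemma sum_borelMult_mul (χ χ' : Fˣ →* ℂ) :
    ∑ i : Irr (SL2 F), (borelMult χ (irrep i) : ℂ) * borelMult χ' (irrep i) =
      (if χ = χ' then 1 else 0) + if χ * χ' = 1 then 1 else 0 := by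
  have hq : (Fintype.card F : ℂ) ≠ 0 := by simp
  have hq1 := card_units_ne_zero (F := F)
  simp only [borelMult]
  rw [sum_charMult_mul_charMult, sum_bruhat, card_borel]
  simp only [← Equiv.sum_comp (borelEquiv (F := F)), Fintype.sum_prod_type, borel_subtype_upper,
    MonoidHom.comp_apply, map_inv (borelDiag (F := F)), borelDiag_upper,
    upper_mul_upper_iff, bigCell_mul_upper_iff]
  have hu (t : Fˣ) : χ t⁻¹ * χ t = 1 := by rw [← map_mul, inv_mul_cancel, map_one]
  have h1 (r : Fˣ) (z : F) : ∑ t : Fˣ, ∑ x : F, ∑ s : Fˣ, ∑ y : F,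
      (if s = t ∧ x = r * (r * y + z * (s : F)⁻¹ - t * z) then χ t⁻¹ * χ' s else 0) =
      Fintype.card F * ∑ t : Fˣ, χ t⁻¹ * χ' t := by
    rw [Finset.mul_sum]
    refine Finset.sum_congr rfl fun t _ => ?_
    rw [Finset.sum_comm]
    rw [Finset.sum_eq_single t]
    · rw [Finset.sum_comm]
      simp
    · intro s _ hs
      simp [hs]
    · simp
  have h2 (c : Fˣ) (a d : F) : ∑ t : Fˣ, ∑ x : F, ∑ s : Fˣ, ∑ y : F,
      (if s = t⁻¹ ∧ x = a * ((t : F)⁻¹ - t) * (c : F)⁻¹ ∧ y = d * ((t : F)⁻¹ - t) * (c : F)⁻¹ then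
        χ t⁻¹ * χ' s else 0) = ∑ t : Fˣ, (χ * χ') t := by
    rw [← Equiv.sum_comp (Equiv.inv Fˣ) (fun t => (χ * χ') t)]
    refine Finset.sum_congr rfl fun t _ => ?_
    rw [Finset.sum_eq_single (a * ((t : F)⁻¹ - t) * (c : F)⁻¹), Finset.sum_eq_single t⁻¹,
      Finset.sum_eq_single (d * ((t : F)⁻¹ - t) * (c : F)⁻¹)]
    · simp
    · intro y _ hy; simp [hy]
    · simp
    · intro s _ hs; simp [hs]
    · simp
    · intro x _ hx; simp [hx]
    · simp
  have h3 : ∑ t : Fˣ, χ t⁻¹ * χ' t = if χ = χ' then (Fintype.card F : ℂ) - 1 else 0 := by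
    let χi : Fˣ →* ℂ := { toFun t := χ t⁻¹, map_one' := by simp, map_mul' := by
                            intro s t; rw [mul_inv, map_mul] }
    have h4 := sum_char_units (χi * χ')
    have h5 : χi * χ' = 1 ↔ χ = χ' := by
      constructor
      · intro h
        ext t
        have h6 : χ t⁻¹ * χ' t = 1 := DFunLike.congr_fun h t
        calc χ t = χ t * (χ t⁻¹ * χ' t) := by rw [h6, mul_one]
          _ = χ' t := by rw [← mul_assoc, mul_comm (χ t), hu, one_mul]
      · rintro rfl
        ext t
        exact hu t
    simp only [h5] at h4
    rw [← h4]
    rfl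
  have h6 : ∑ x : Fˣ, ∑ x_1 : F, ∑ t : Fˣ, ∑ x_2 : F, ∑ s : Fˣ, ∑ y : F,
      (if s = t ∧ x_2 = x * (x * y + x_1 * (s : F)⁻¹ - t * x_1) then χ t⁻¹ * χ' s else 0) =
      ∑ x : Fˣ, ∑ x_1 : F, Fintype.card F * ∑ t : Fˣ, χ t⁻¹ * χ' t :=
    Finset.sum_congr rfl fun r _ => Finset.sum_congr rfl fun z _ => h1 r z
  rw [h6]
  simp only [h2, sum_char_units, h3, Finset.sum_const, Finset.card_univ, nsmul_eq_mul,
    card_units_cast]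
  split_ifs <;> field_simp <;> ring

lemma sum_borelMult_mul_finrank (χ : Fˣ →* ℂ) :
    ∑ i : Irr (SL2 F), (borelMult χ (irrep i) : ℂ) * Module.finrank ℂ (irrep i) =
      Fintype.card F + 1 := by
  have hq : (Fintype.card F : ℂ) ≠ 0 := by simp
  have hq1 := card_units_ne_zero (F := F)
  simp only [borelMult]
  rw [sum_charMult_mul_finrank _ _ (Subgroup.subtype_injective _), card_borel, card_SL2]
  field_simp

end
end TensorRank

namespace TensorRank
noncomputable section
universe u
variable {F : Type u} [Field F] [Fintype F] {ψ : AddChar F ℂ}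

/-! ### Fourier analysis on the unipotent subgroup -/

section Fourier

/-- Fourier inversion on F: every additive character is ψ(a·) for one a, as ψ is primitive. -/
lemma char_unip (hψ : ψ.IsPrimitive) (V : FDRep ℂ (SL2 F)) (x : F) :
    V.character (unip (.ofAdd x)) = ∑ a : F, (unipMult ψ a V : ℂ) * ψ (a * x) := by
  classical
  have hq : (Fintype.card F : ℂ) ≠ 0 := by simp
  have h (a : F) : (unipMult ψ a V : ℂ) * ψ (a * x) = ∑ y : F, (Fintype.card F : ℂ)⁻¹ *
      V.character (unip (.ofAdd y)) * ψ (a * (x - y)) := by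
    rw [unipMult_eq, mul_assoc, Finset.sum_mul, Finset.mul_sum]
    refine Finset.sum_congr rfl fun y _ => ?_
    rw [show a * (x - y) = -(a * y) + a * x by ring, AddChar.map_add_eq_mul]
    ring
  rw [Finset.sum_congr rfl fun a _ => h a, Finset.sum_comm]
  simp only [← Finset.mul_sum, AddChar.sum_mulShift _ hψ]
  rw [Finset.sum_eq_single x]
  · simp; field_simp
  · intro y _ hy
    simp [sub_eq_zero, hy.symm]
  · simp

lemma finrank_eq_sum_unipMult (hψ : ψ.IsPrimitive) (V : FDRep ℂ (SL2 F)) :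
    Module.finrank ℂ V = ∑ a : F, unipMult ψ a V := by
  have h := char_unip hψ V 0
  rw [ofAdd_zero, map_one, FDRep.char_one] at h
  simp only [mul_zero, AddChar.map_zero_eq_one, mul_one] at h
  exact_mod_cast h

omit [Fintype F] in
lemma char_unip_sq_mul (V : FDRep ℂ (SL2 F)) (t : Fˣ) (x : F) :
    V.character (unip (.ofAdd (t ^ 2 * x))) = V.character (unip (.ofAdd x)) := by
  have h := (upper_mul_unip_iff t 0 (t ^ 2 * x) x).2 rfl
  rw [← V.char_conj (unip (.ofAdd x)) (upper t 0), h, mul_inv_cancel_right]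

/-- Conjugation by diag(t, t⁻¹) multiplies the unipotent coordinate by t². -/
lemma unipMult_mul_sq (a : F) (t : Fˣ) (V : FDRep ℂ (SL2 F)) :
    unipMult ψ (a * t ^ 2) V = unipMult ψ a V := by
  have h := unipMult_eq ψ a V
  rw [← Equiv.sum_comp (Units.mulLeft (t ^ 2))] at h
  have h2 := unipMult_eq ψ (a * t ^ 2) V
  have : (unipMult ψ (a * t ^ 2) V : ℂ) = unipMult ψ a V := by
    rw [h, h2]
    congr 1
    refine Finset.sum_congr rfl fun x _ => ?_
    rw [Units.mulLeft_apply, Units.val_pow_eq_pow_val, char_unip_sq_mul, mul_assoc]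
  exact_mod_cast this

/-- Multiplicities convolve, since ψ(a·)ψ(b·) = ψ((a+b)·). -/
lemma unipMult_tensor (hψ : ψ.IsPrimitive) (c : F) (V W : FDRep ℂ (SL2 F)) :
    unipMult ψ c (V ⊗ W) = ∑ a : F, unipMult ψ a V * unipMult ψ (c - a) W := by
  have : (unipMult ψ c (V ⊗ W) : ℂ) =
      ∑ a : F, (unipMult ψ a V : ℂ) * unipMult ψ (c - a) W := by
    simp only [unipMult_eq ψ _ W]
    rw [unipMult_eq]
    simp only [FDRep.char_tensor, Pi.mul_apply, char_unip hψ V, Finset.mul_sum, Finset.sum_mul]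
    rw [Finset.sum_comm]
    refine Finset.sum_congr rfl fun a _ => Finset.sum_congr rfl fun x _ => ?_
    rw [show -((c - a) * x) = -(c * x) + a * x by ring, AddChar.map_add_eq_mul]
    ring
  exact_mod_cast this

lemma unipMult_congr {V W : FDRep ℂ (SL2 F)} (h : V.character = W.character) (a : F) :
    unipMult ψ a V = unipMult ψ a W := charMult_congr _ _ h

lemma unipMult_eq_sum (a : F) (V : FDRep ℂ (SL2 F)) [DecidableEq F] : unipMult ψ a V =
    ∑ i : Irr (SL2 F), Module.finrank ℂ (irrep i ⟶ V) * unipMult ψ a (irrep i) :=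
  charMult_eq_sum _ _ V

lemma borelMult_congr {V W : FDRep ℂ (SL2 F)} (h : V.character = W.character) (χ : Fˣ →* ℂ) :
    borelMult χ V = borelMult χ W := charMult_congr _ _ h

lemma borelMult_eq_sum (χ : Fˣ →* ℂ) (V : FDRep ℂ (SL2 F)) : borelMult χ V =
    ∑ i : Irr (SL2 F), Module.finrank ℂ (irrep i ⟶ V) * borelMult χ (irrep i) :=
  charMult_eq_sum _ _ V

variable [DecidableEq F]

/-- The multiplicative form of a character of `Additive Fˣ`. -/
def mulForm : AddChar (Additive Fˣ) ℂ ≃ (Fˣ →* ℂ) where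
  toFun θ :=
    { toFun t := θ (.ofMul t)
      map_one' := θ.map_zero_eq_one
      map_mul' _ _ := θ.map_add_eq_mul _ _ }
  invFun χ :=
    { toFun t := χ t.toMul
      map_zero_eq_one' := χ.map_one
      map_add_eq_mul' _ _ := χ.map_mul _ _ }
  left_inv _ := rfl
  right_inv _ := rfl

/-- The torus acts on the U-fixed vectors, which split into its eigenspaces. In terms of characters,
summing over all θ keeps only t = 1. -/
lemma unipMult_zero_eq_sum (V : FDRep ℂ (SL2 F)) :
    unipMult ψ 0 V = ∑ θ : AddChar (Additive Fˣ) ℂ, borelMult (mulForm θ) V := by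
  have : (unipMult ψ 0 V : ℂ) = ∑ θ : AddChar (Additive Fˣ) ℂ, (borelMult (mulForm θ) V : ℂ) := by
    have hq : (Fintype.card F : ℂ) ≠ 0 := by simp
    have hq1 := card_units_ne_zero (F := F)
    simp only [borelMult_eq, ← Finset.mul_sum]
    rw [Finset.sum_comm]
    simp only [← Finset.sum_mul]
    have h (t : Fˣ) : ∑ θ : AddChar (Additive Fˣ) ℂ, mulForm θ t⁻¹ =
        if t = 1 then (Fintype.card F : ℂ) - 1 else 0 := by
      change ∑ θ : AddChar (Additive Fˣ) ℂ, θ (.ofMul t⁻¹) = _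
      rw [AddChar.sum_apply_eq_ite]
      simp only [ofMul_eq_zero, inv_eq_one, Fintype.card_additive, card_units_cast]
    simp only [h, ite_mul, zero_mul]
    rw [Finset.sum_ite_eq' Finset.univ, if_pos (Finset.mem_univ _), unipMult_eq]
    have h3 (x : F) : upper 1 x = unip (.ofAdd x) := by
      rw [SL2_ext_iff]; simp
    simp only [h3, zero_mul, neg_zero, AddChar.map_zero_eq_one, one_mul]
    field_simp
  exact_mod_cast this

end Fourier

/-! ### Gelfand's trick and uniqueness of Whittaker models -/

section Gelfand

/-- The anti-involution of `SL2 F` exchanging the diagonal entries. -/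
def flipDiag (g : SL2 F) : SL2 F :=
  ⟨!![g.1 1 1, g.1 0 1; g.1 1 0, g.1 0 0], by
    rw [Matrix.det_fin_two_of]
    linear_combination SL2_det g⟩

omit [Fintype F] in
lemma flipDiag_mul (g h : SL2 F) : flipDiag (g * h) = flipDiag h * flipDiag g := by
  rw [SL2_ext_iff]
  simp only [SL2_mul_apply]
  simp only [flipDiag, SL2_mul_apply, Matrix.of_apply, Matrix.cons_val', Matrix.cons_val_zero,
    Matrix.cons_val_one, Matrix.cons_val_fin_one]
  refine ⟨by ring, by ring, by ring, by ring⟩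

omit [Fintype F] in
lemma flipDiag_unip (x : Multiplicative F) : flipDiag (unip x) = unip x := by
  rw [SL2_ext_iff]
  exact ⟨rfl, rfl, rfl, rfl⟩

variable (V : FDRep ℂ (SL2 F)) (φ : AddChar F ℂ)

/-- The projection onto the `φ`-eigenvectors of the unipotent subgroup. -/
def unipProj : Module.End ℂ V :=
  (Fintype.card F : ℂ)⁻¹ • ∑ x : F, φ (-x) • V.ρ (unip (.ofAdd x))

/-- The Hecke operator attached to `g`. -/
def heckeOp (g : SL2 F) : Module.End ℂ V := unipProj V φ * V.ρ g * unipProj V φ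

lemma unip_mul_unipProj (x : F) : V.ρ (unip (.ofAdd x)) * unipProj V φ = φ x • unipProj V φ := by
  rw [unipProj, mul_smul_comm, smul_comm (φ x), Finset.mul_sum, Finset.smul_sum (r := φ x)]
  congr 1
  refine Fintype.sum_equiv (Equiv.addLeft x) _ _ fun y => ?_
  rw [Equiv.coe_addLeft, mul_smul_comm, smul_smul, ← rho_mul, ← map_mul, ← ofAdd_add,
    ← AddChar.map_add_eq_mul]
  congr 2; ring

lemma unipProj_mul_unip (x : F) : unipProj V φ * V.ρ (unip (.ofAdd x)) = φ x • unipProj V φ := by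
  rw [unipProj, smul_mul_assoc, smul_comm (φ x), Finset.sum_mul, Finset.smul_sum (r := φ x)]
  congr 1
  refine Fintype.sum_equiv (Equiv.addRight x) _ _ fun y => ?_
  rw [Equiv.coe_addRight, smul_mul_assoc, smul_smul, ← rho_mul, ← map_mul, ← ofAdd_add,
    ← AddChar.map_add_eq_mul]
  congr 2; ring

lemma unipProj_apply {v : V} (hv : ∀ x, V.ρ (unip (.ofAdd x)) v = φ x • v) :
    unipProj V φ v = v := by
  have h (x : F) : φ (-x) * φ x = 1 := by
    rw [← AddChar.map_add_eq_mul, neg_add_cancel, AddChar.map_zero_eq_one]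
  simp only [unipProj, LinearMap.smul_apply, LinearMap.sum_apply, hv, smul_smul, h, one_smul,
    Finset.sum_const, Finset.card_univ]
  rw [← Nat.cast_smul_eq_nsmul ℂ, smul_smul, inv_mul_cancel₀ (by simp), one_smul]

lemma unipProj_mul_self : unipProj V φ * unipProj V φ = unipProj V φ := by
  ext v
  rw [Module.End.mul_apply]
  exact unipProj_apply V φ fun x => LinearMap.congr_fun (unip_mul_unipProj V φ x) v

lemma trace_unipProj : LinearMap.trace ℂ V (unipProj V φ) = unipMult φ 1 V := by
  rw [unipMult_eq, unipProj, map_smul, map_sum, smul_eq_mul]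
  congr 1
  refine Finset.sum_congr rfl fun x _ => ?_
  rw [map_smul, one_mul]; rfl

lemma heckeOp_unip_mul_mul (g : SL2 F) (x y : F) :
    heckeOp V φ (unip (.ofAdd x) * g * unip (.ofAdd y)) = (φ x * φ y) • heckeOp V φ g := by
  rw [heckeOp, rho_mul, rho_mul, mul_assoc _ _ (unipProj V φ), mul_assoc _ _ (unipProj V φ),
    unip_mul_unipProj, ← mul_assoc, ← mul_assoc, unipProj_mul_unip, mul_smul_comm, smul_mul_assoc,
    smul_mul_assoc, smul_smul, mul_comm (φ x)]
  rfl

lemma heckeOp_mul_heckeOp (g h : SL2 F) : heckeOp V φ g * heckeOp V φ h =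
    (Fintype.card F : ℂ)⁻¹ • ∑ x : F, φ (-x) • heckeOp V φ (g * unip (.ofAdd x) * h) := by
  have h1 : heckeOp V φ g * heckeOp V φ h =
      unipProj V φ * V.ρ g * unipProj V φ * V.ρ h * unipProj V φ := by
    simp only [heckeOp, mul_assoc]
    rw [← mul_assoc (unipProj V φ) (unipProj V φ), unipProj_mul_self]
  rw [h1]
  conv_lhs => enter [1, 1, 2]; rw [unipProj]
  simp only [mul_smul_comm, smul_mul_assoc, Finset.mul_sum, Finset.sum_mul, heckeOp, rho_mul,
    mul_assoc]

variable {V φ}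

/-- Moving a unipotent element across g replaces x by t²x, so the operator would intertwine two
characters that differ when t² ≠ 1. -/
lemma heckeOp_upper_eq_zero (hφ : φ.IsPrimitive) {t : Fˣ} (ht : t ≠ t⁻¹) (z : F) :
    heckeOp V φ (upper t z) = 0 := by
  have ht' : (t : F) ^ 2 - 1 ≠ 0 := by
    intro h
    apply ht
    rw [eq_inv_iff_mul_eq_one]
    ext
    push_cast
    linear_combination h
  obtain ⟨x, hx⟩ := AddChar.ne_one_iff.1 (hφ ht')
  rw [AddChar.mulShift_apply] at hx
  have h1 := (upper_mul_unip_iff t z (t ^ 2 * x) x).2 rfl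
  have h2 := heckeOp_unip_mul_mul V φ (upper t z) 0 x
  have h3 := heckeOp_unip_mul_mul V φ (upper t z) (t ^ 2 * x) 0
  rw [ofAdd_zero, map_one, one_mul, h1, AddChar.map_zero_eq_one, one_mul] at h2
  rw [ofAdd_zero, map_one, mul_one, h2, AddChar.map_zero_eq_one, mul_one] at h3
  by_contra h0
  apply hx
  have h4 := smul_left_injective ℂ h0 h3
  have h5 : φ (-x) * φ x = 1 := by
    rw [← AddChar.map_add_eq_mul, neg_add_cancel, AddChar.map_zero_eq_one]
  rw [show ((t : F) ^ 2 - 1) * x = t ^ 2 * x + -x by ring, AddChar.map_add_eq_mul, ← h4, mul_comm,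
    h5]

/-- The flip inverts t on the Borel cell, where the operator vanishes unless t = t⁻¹. On the big
cell the operator depends on the diagonal only through φ(a/c)φ(d/c), which is symmetric. -/
lemma heckeOp_flipDiag (hφ : φ.IsPrimitive) (g : SL2 F) :
    heckeOp V φ (flipDiag g) = heckeOp V φ g := by
  by_cases hc : g.1 1 0 = 0
  · have hdet := SL2_det g
    rw [hc, mul_zero, sub_zero] at hdet
    let t : Fˣ := Units.mkOfMulEqOne _ _ hdet
    have h1 : g = upper t (g.1 0 1) := by
      rw [SL2_ext_iff]
      exact ⟨rfl, rfl, hc, rfl⟩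
    have h2 : flipDiag g = upper t⁻¹ (g.1 0 1) := by
      rw [SL2_ext_iff]
      exact ⟨rfl, rfl, hc, rfl⟩
    by_cases ht : t = t⁻¹
    · rw [h2, ← ht, ← h1]
    · rw [h2, h1, heckeOp_upper_eq_zero hφ (fun h => ht ?_), heckeOp_upper_eq_zero hφ ht]
      rwa [inv_inv, eq_comm] at h
  · have key (a d : F) : bigCell (Units.mk0 _ hc) a d =
        unip (.ofAdd (a * (g.1 1 0)⁻¹)) * bigCell (Units.mk0 _ hc) 0 0 *
          unip (.ofAdd (d * (g.1 1 0)⁻¹)) := by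
      rw [SL2_ext_iff]
      simp only [SL2_mul_apply, bigCell_apply_00, bigCell_apply_01, bigCell_apply_10,
        bigCell_apply_11, unip_apply_00, unip_apply_01, unip_apply_10, unip_apply_11, toAdd_ofAdd,
        Units.val_inv_eq_inv_val, Units.val_mk0]
      refine ⟨by field_simp; ring, by field_simp; ring, by ring, by field_simp; ring⟩
    have hb : g.1 0 1 = (g.1 0 0 * g.1 1 1 - 1) * (g.1 1 0)⁻¹ := by
      have := SL2_det g
      field_simp
      linear_combination -this
    have h1 : g = bigCell (Units.mk0 _ hc) (g.1 0 0) (g.1 1 1) := by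
      rw [SL2_ext_iff]
      exact ⟨rfl, hb, rfl, rfl⟩
    have h2 : flipDiag g = bigCell (Units.mk0 _ hc) (g.1 1 1) (g.1 0 0) := by
      rw [SL2_ext_iff]
      refine ⟨rfl, ?_, rfl, rfl⟩
      rw [bigCell_apply_01, mul_comm (g.1 1 1)]
      exact hb
    rw [h2, key, heckeOp_unip_mul_mul]
    conv_rhs => rw [h1, key, heckeOp_unip_mul_mul]
    rw [mul_comm (φ _)]

/-- An anti-involution that fixes every Hecke operator reverses products without changing them. -/
lemma heckeOp_comm (hφ : φ.IsPrimitive) (g h : SL2 F) :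
    heckeOp V φ g * heckeOp V φ h = heckeOp V φ h * heckeOp V φ g := by
  rw [heckeOp_mul_heckeOp]
  have h1 (x : F) : heckeOp V φ (g * unip (.ofAdd x) * h) =
      heckeOp V φ (flipDiag h * unip (.ofAdd x) * flipDiag g) := by
    rw [← heckeOp_flipDiag hφ, flipDiag_mul, flipDiag_mul, flipDiag_unip, mul_assoc]
  simp only [h1]
  rw [← heckeOp_mul_heckeOp, heckeOp_flipDiag hφ, heckeOp_flipDiag hφ]

lemma sum_heckeOp_conj [DecidableEq F] [Simple V] {M : Module.End ℂ V}
    (hM : unipProj V φ * M * unipProj V φ = M) :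
    ∑ g : SL2 F, heckeOp V φ g * M * heckeOp V φ g⁻¹ =
      ((Fintype.card (SL2 F) : ℂ) * LinearMap.trace ℂ V M / Module.finrank ℂ V) •
        unipProj V φ := by
  have h1 (g : SL2 F) : heckeOp V φ g * M * heckeOp V φ g⁻¹ =
      unipProj V φ * (V.ρ g * M * V.ρ g⁻¹) * unipProj V φ := by
    conv_rhs => rw [← hM]
    simp only [heckeOp, mul_assoc]
  rw [Finset.sum_congr rfl fun g _ => h1 g, ← Finset.sum_mul, ← Finset.mul_sum, sum_conj_eq,
    mul_smul_comm, smul_mul_assoc, mul_one, unipProj_mul_self]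

lemma unipProj_heckeOp (g : SL2 F) :
    unipProj V φ * heckeOp V φ g * unipProj V φ = heckeOp V φ g := by
  simp only [heckeOp, ← mul_assoc, unipProj_mul_self]
  rw [mul_assoc _ (unipProj V φ), unipProj_mul_self]

/-- Uniqueness of Whittaker models. -/
lemma unipMult_one_le_one (hφ : φ.IsPrimitive) [Simple V] : unipMult φ 1 V ≤ 1 := by
  classical
  rcases Nat.eq_zero_or_pos (unipMult φ 1 V) with h0 | h0
  · omega
  set P := unipProj V φ with hP
  set f : ℂ := LinearMap.trace ℂ V P with hf
  have hf0 : f ≠ 0 := by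
    rw [hf, trace_unipProj]; exact_mod_cast h0.ne'
  have hP0 : P ≠ 0 := by
    intro h; rw [hf, h, map_zero] at hf0; exact hf0 rfl
  have hPP : P * P = P := unipProj_mul_self V φ
  set κ : ℂ := (Fintype.card (SL2 F) : ℂ) / Module.finrank ℂ V with hκ
  have hκ0 : κ ≠ 0 := by
    have hD : (Module.finrank ℂ V : ℂ) ≠ 0 := by
      exact_mod_cast (finrank_pos_of_simple V).ne'
    exact div_ne_zero (by simp) hD
  have hsum {M : Module.End ℂ V} (hM : P * M * P = M) :
      ∑ g : SL2 F, heckeOp V φ g * M * heckeOp V φ g⁻¹ =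
        (κ * LinearMap.trace ℂ V M) • P := by
    rw [sum_heckeOp_conj hM, hκ, div_mul_eq_mul_div]
  have hTP (h : SL2 F) : heckeOp V φ h * P = heckeOp V φ h := by
    rw [heckeOp, mul_assoc, hPP]
  -- Write T_g for the Hecke operator of g and evaluate Σ T_g T_h T_{g⁻¹} twice: commutativity pulls
  -- T_h out in front of Σ T_g T_{g⁻¹} = κfP, and Schur gives κ tr(T_h) P. So every T_h is a
  -- multiple of P.
  have hT (h : SL2 F) : f • heckeOp V φ h = LinearMap.trace ℂ V (heckeOp V φ h) • P := by
    have h1 := hsum (unipProj_heckeOp (V := V) (φ := φ) h)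
    have h2 := hsum (M := P) (by rw [hPP, hPP])
    simp only [hTP] at h2
    simp only [heckeOp_comm hφ _ h, mul_assoc, ← Finset.mul_sum] at h1
    rw [h2, mul_smul_comm, hTP, mul_smul, mul_smul] at h1
    exact smul_right_injective _ hκ0 h1
  have hT' (h : SL2 F) : heckeOp V φ h = (f⁻¹ * LinearMap.trace ℂ V (heckeOp V φ h)) • P := by
    rw [mul_smul, ← hT, smul_smul, inv_mul_cancel₀ hf0, one_smul]
  -- With all T_g scalar on the image of P, the same sum around any M = PMP is cM; since it is also
  -- a multiple of P, the algebra P End(V) P is one-dimensional.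
  obtain ⟨c, hc⟩ : ∃ c : ℂ, ∀ M : Module.End ℂ V, P * M * P = M →
      c • M = (κ * LinearMap.trace ℂ V M) • P := by
    refine ⟨∑ g : SL2 F, (f⁻¹ * LinearMap.trace ℂ V (heckeOp V φ g)) *
      (f⁻¹ * LinearMap.trace ℂ V (heckeOp V φ g⁻¹)), fun M hM => ?_⟩
    rw [← hsum hM, Finset.sum_smul]
    refine Finset.sum_congr rfl fun g _ => ?_
    conv_rhs => rw [hT' g, hT' g⁻¹]
    rw [smul_mul_assoc, smul_mul_smul_comm, hM]
  have hc0 : c ≠ 0 := by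
    intro h
    have h1 := hc P (by rw [hPP, hPP])
    rw [h, zero_smul] at h1
    exact smul_ne_zero (mul_ne_zero hκ0 hf0) hP0 h1.symm
  have hmem {v : V} (hv : v ∈ eigenvectors unip (AddChar.mulShift φ 1).toMonoidHom V) :
      P v = v := by
    refine unipProj_apply V φ fun x => ?_
    rw [hv (.ofAdd x)]
    change φ (1 * x) • v = _
    rw [one_mul]
  obtain ⟨v, hv0, hv⟩ := (charMult_pos_iff _ _ V).1 h0
  refine finrank_le_one (⟨v, hv⟩ : eigenvectors unip (AddChar.mulShift φ 1).toMonoidHom V) ?_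
  rintro ⟨w, hw⟩
  obtain ⟨l, hl⟩ := not_forall.1 (mt (Module.forall_dual_apply_eq_zero_iff ℂ v).1 hv0)
  -- Test on the rank-one operator sending v to l(v)w: w must be a multiple of v.
  have h1 := hc (P * l.smulRight w * P)
    (by simp only [mul_assoc, hPP]; simp only [← mul_assoc, hPP])
  have h2 := LinearMap.congr_fun h1 v
  simp only [LinearMap.smul_apply, Module.End.mul_apply, hmem hv, LinearMap.smulRight_apply,
    map_smul, hmem hw] at h2
  refine ⟨(c * l v)⁻¹ * (κ * LinearMap.trace ℂ V (P * l.smulRight w * P)), Subtype.ext ?_⟩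
  change ((c * l v)⁻¹ * _) • v = w
  rw [mul_smul, ← h2, smul_smul, smul_smul, mul_assoc, inv_mul_cancel₀ (mul_ne_zero hc0 hl),
    one_smul]

end Gelfand

lemma unipMult_le_one (hψ : ψ.IsPrimitive) {a : F} (ha : a ≠ 0) (V : FDRep ℂ (SL2 F)) [Simple V] :
    unipMult ψ a V ≤ 1 := by
  have hφ : (AddChar.mulShift ψ a).IsPrimitive := AddChar.IsPrimitive.of_ne_one (hψ ha)
  have h := unipMult_one_le_one (V := V) hφ
  rwa [unipMult, AddChar.mulShift_mulShift, mul_one] at h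

end
end TensorRank

namespace TensorRank
noncomputable section
universe u

lemma eq_pair_of_sum_mul_self_eq_two {ι : Type*} [Fintype ι] (b : ι → ℕ)
    (h : ∑ i, b i * b i = 2) :
    ∃ i j, i ≠ j ∧ b i = 1 ∧ b j = 1 ∧ ∀ k, k ≠ i → k ≠ j → b k = 0 := by
  classical
  have h1 (i : ι) : b i ≤ 1 := by
    have h2 := Finset.single_le_sum (f := fun i => b i * b i) (fun _ _ => Nat.zero_le _)
      (Finset.mem_univ i)
    rw [h] at h2
    by_contra h3
    nlinarith
  have h2 (i : ι) : b i * b i = if b i = 1 then 1 else 0 := by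
    have := h1 i
    interval_cases b i <;> simp
  simp only [h2, Finset.sum_boole, Nat.cast_id] at h
  obtain ⟨i, j, hij, hs⟩ := Finset.card_eq_two.1 h
  have hm (k : ι) : b k = 1 ↔ k = i ∨ k = j := by
    have : k ∈ (Finset.univ.filter fun x => b x = 1) ↔ k ∈ ({i, j} : Finset ι) := by rw [hs]
    simpa using this
  refine ⟨i, j, hij, (hm i).2 (.inl rfl), (hm j).2 (.inr rfl), fun k hki hkj => ?_⟩
  have := h1 k
  have h3 : b k ≠ 1 := fun h => ((hm k).1 h).elim hki hkj
  omega

variable {F : Type u} [Field F] [Fintype F] {ψ : AddChar F ℂ}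

/-! ### Square classes and the number of asymmetric irreps -/

section Square
variable [DecidableEq F] {ε : F}

lemma unipMult_eq_of_quadraticChar (hε : quadraticChar F ε = -1) (V : FDRep ℂ (SL2 F)) {a : F}
    (ha : a ≠ 0) :
    unipMult ψ a V = if quadraticChar F a = 1 then unipMult ψ 1 V else unipMult ψ ε V := by
  have hε0 : ε ≠ 0 := by
    rintro rfl; simp at hε
  split_ifs with h
  · obtain ⟨t, ht⟩ := (quadraticChar_one_iff_isSquare ha).1 h
    have ht0 : t ≠ 0 := by rintro rfl; simp at ht; exact ha ht
    have := unipMult_mul_sq (ψ := ψ) 1 (Units.mk0 t ht0) V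
    rwa [Units.val_mk0, one_mul, sq, ← ht] at this
  · have h' : quadraticChar F a = -1 := (quadraticChar_dichotomy ha).resolve_left h
    have h2 : quadraticChar F (a * ε) = 1 := by rw [map_mul, h', hε]; norm_num
    obtain ⟨t, ht⟩ := (quadraticChar_one_iff_isSquare (mul_ne_zero ha hε0)).1 h2
    have ht0 : t ≠ 0 := by rintro rfl; simp [ha, hε0] at ht
    -- From aε = t² one gets a = ε(t/ε)².
    have := unipMult_mul_sq (ψ := ψ) ε (Units.mk0 (t / ε) (div_ne_zero ht0 hε0)) V
    rw [Units.val_mk0] at this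
    rw [← this]
    congr 1
    field_simp
    linear_combination ht

lemma two_mul_sum_unipMult (hF : ringChar F ≠ 2) (hε : quadraticChar F ε = -1)
    (V : FDRep ℂ (SL2 F)) : 2 * ∑ a : F, (unipMult ψ a V : ℤ) =
      2 * unipMult ψ 0 V + (Fintype.card F - 1) * (unipMult ψ 1 V + unipMult ψ ε V) := by
  -- Interpolate by the quadratic character, whose sum is zero; no count of squares is needed.
  have h (a : F) : 2 * (unipMult ψ a V : ℤ) = (unipMult ψ 1 V + unipMult ψ ε V) +
      quadraticChar F a * (unipMult ψ 1 V - unipMult ψ ε V) +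
      if a = 0 then 2 * (unipMult ψ 0 V : ℤ) - (unipMult ψ 1 V + unipMult ψ ε V) else 0 := by
    split_ifs with ha
    · rw [ha, quadraticChar_zero]; ring
    · rw [unipMult_eq_of_quadraticChar hε V ha]
      rcases quadraticChar_dichotomy ha with h | h
      · rw [if_pos h, h]; ring
      · rw [if_neg (by rw [h]; norm_num), h]; ring
  rw [Finset.mul_sum, Finset.sum_congr rfl fun a _ => h a, Finset.sum_add_distrib,
    Finset.sum_add_distrib, ← Finset.sum_mul, quadraticChar_sum_zero hF]
  simp
  ring

lemma two_mul_finrank (hψ : ψ.IsPrimitive) (hF : ringChar F ≠ 2) (hε : quadraticChar F ε = -1)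
    (V : FDRep ℂ (SL2 F)) : 2 * (Module.finrank ℂ V : ℤ) =
      2 * unipMult ψ 0 V + (Fintype.card F - 1) * (unipMult ψ 1 V + unipMult ψ ε V) := by
  rw [← two_mul_sum_unipMult hF hε, finrank_eq_sum_unipMult hψ, Nat.cast_sum]

lemma sum_ite_sq_eq_one (hF : ringChar F ≠ 2) :
    ∑ t : Fˣ, (if (t : F) ^ 2 = 1 then (1 : ℂ) else 0) = 2 := by
  rw [Finset.sum_boole]
  have : (Finset.univ.filter fun t : Fˣ => (t : F) ^ 2 = 1) = {1, -1} := by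
    ext t
    simp only [Finset.mem_filter, Finset.mem_univ, true_and, Finset.mem_insert,
      Finset.mem_singleton, sq_eq_one_iff, Units.ext_iff, Units.val_neg, Units.val_one]
  rw [this, Finset.card_pair]
  · norm_num
  · intro h
    have h1 : (1 : F) = -1 := by simpa using congrArg Units.val h
    exact Ring.neg_one_ne_one_of_char_ne_two hF h1.symm

/-- Both multiplicities are 0 or 1, so the count is Σ(m_1 - m_ε)² = (q+1) + (q+1) - 2(q-1) = 4. -/
lemma card_unipMult_ne (hψ : ψ.IsPrimitive) (hF : ringChar F ≠ 2) (hε : quadraticChar F ε = -1) :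
    (Finset.univ.filter fun i : Irr (SL2 F) =>
      unipMult ψ 1 (irrep i) ≠ unipMult ψ ε (irrep i)).card = 4 := by
  have hε0 : ε ≠ 0 := by
    rintro rfl; simp at hε
  have hns (t : Fˣ) : (t : F) ^ 2 ≠ ε := by
    intro h
    rw [← h, quadraticChar_sq_one' t.ne_zero] at hε
    norm_num at hε
  have h1 := sum_unipMult_mul hψ 1 1
  have h2 := sum_unipMult_mul hψ ε ε
  have h3 := sum_unipMult_mul hψ 1 ε
  simp only [one_mul, sum_ite_sq_eq_one hF] at h1
  simp only [mul_eq_left₀ hε0, sum_ite_sq_eq_one hF] at h2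
  simp only [one_mul, hns, if_false, Finset.sum_const_zero, add_zero] at h3
  have h4 (i : Irr (SL2 F)) : ((unipMult ψ 1 (irrep i) : ℂ) - unipMult ψ ε (irrep i)) ^ 2 =
      if unipMult ψ 1 (irrep i) ≠ unipMult ψ ε (irrep i) then 1 else 0 := by
    have h5 := unipMult_le_one hψ one_ne_zero (irrep i)
    have h6 := unipMult_le_one hψ hε0 (irrep i)
    interval_cases unipMult ψ 1 (irrep i) <;> interval_cases unipMult ψ ε (irrep i) <;> simp
  have h5 : ∑ i : Irr (SL2 F), ((unipMult ψ 1 (irrep i) : ℂ) - unipMult ψ ε (irrep i)) ^ 2 = 4 := by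
    have h6 (i : Irr (SL2 F)) : ((unipMult ψ 1 (irrep i) : ℂ) - unipMult ψ ε (irrep i)) ^ 2 =
        (unipMult ψ 1 (irrep i) : ℂ) * unipMult ψ 1 (irrep i) +
        (unipMult ψ ε (irrep i) : ℂ) * unipMult ψ ε (irrep i) -
        2 * ((unipMult ψ 1 (irrep i) : ℂ) * unipMult ψ ε (irrep i)) := by ring
    simp only [h6, Finset.sum_sub_distrib, Finset.sum_add_distrib, ← Finset.mul_sum, h1, h2, h3]
    ring
  simp only [h4, Finset.sum_boole] at h5
  exact_mod_cast h5

end Square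

/-! ### Constituents of the principal series -/

section Borel
variable [DecidableEq F]

omit [Fintype F] [DecidableEq F] in
lemma borelMult_trivial : 0 < borelMult (1 : Fˣ →* ℂ) (𝟙_ (FDRep ℂ (SL2 F))) :=
  (charMult_pos_iff _ _ _).2 ⟨show ℂ from 1, one_ne_zero (α := ℂ),
    fun _ => (one_smul ℂ (1 : ℂ)).symm⟩

open Classical in
lemma sum_borelMult_mul_nat (χ χ' : Fˣ →* ℂ) :
    ∑ i : Irr (SL2 F), borelMult χ (irrep i) * borelMult χ' (irrep i) =
      (if χ = χ' then 1 else 0) + if χ * χ' = 1 then 1 else 0 := by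
  have := sum_borelMult_mul χ χ'
  exact_mod_cast this

omit [Fintype F] [DecidableEq F] in
lemma exists_iso_irrep (V : FDRep ℂ (SL2 F)) [Simple V] :
    ∃ i : Irr (SL2 F), V.character = (irrep i).character ∧ Nonempty (V ≅ irrep i) := by
  obtain ⟨i, ⟨e⟩⟩ := exists_irrep V
  exact ⟨i, FDRep.char_iso e, ⟨e⟩⟩

open Classical in
lemma borelMult_mul_le (χ χ' : Fˣ →* ℂ) (V : FDRep ℂ (SL2 F)) [Simple V] :
    borelMult χ V * borelMult χ' V ≤
      (if χ = χ' then 1 else 0) + if χ * χ' = 1 then 1 else 0 := by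
  obtain ⟨i, hi, -⟩ := exists_iso_irrep V
  rw [borelMult_congr hi, borelMult_congr hi, ← sum_borelMult_mul_nat]
  exact Finset.single_le_sum (f := fun i => borelMult χ (irrep i) * borelMult χ' (irrep i))
    (fun _ _ => Nat.zero_le _) (Finset.mem_univ i)

/-- Once χ occurs, only χ and χ⁻¹ can occur, with total multiplicity bounded by the intertwining
numbers. -/
lemma unipMult_zero_le_two {χ : Fˣ →* ℂ} {V : FDRep ℂ (SL2 F)} [Simple V]
    (h : 0 < borelMult χ V) : unipMult ψ 0 V ≤ 2 := by
  classical
  rw [unipMult_zero_eq_sum]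
  calc ∑ θ, borelMult (mulForm θ) V ≤ ∑ θ, borelMult χ V * borelMult (mulForm θ) V :=
        Finset.sum_le_sum fun θ _ => Nat.le_mul_of_pos_left _ h
    _ ≤ ∑ θ, ((if χ = mulForm θ then 1 else 0) + if χ * mulForm θ = 1 then 1 else 0) :=
        Finset.sum_le_sum fun θ _ => borelMult_mul_le _ _ V
    _ ≤ 2 := by
        rw [Finset.sum_add_distrib]
        have h1 : ∑ θ : AddChar (Additive Fˣ) ℂ, (if χ = mulForm θ then 1 else 0) ≤ 1 := by
          rw [Finset.sum_boole, Nat.cast_id, Finset.card_le_one]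
          intro a ha b hb
          rw [Finset.mem_filter] at ha hb
          exact mulForm.injective (ha.2.symm.trans hb.2)
        have h2 : ∑ θ : AddChar (Additive Fˣ) ℂ, (if χ * mulForm θ = 1 then 1 else 0) ≤ 1 := by
          rw [Finset.sum_boole, Nat.cast_id, Finset.card_le_one]
          intro a ha b hb
          rw [Finset.mem_filter] at ha hb
          apply mulForm.injective
          ext t
          have h3 : χ t * mulForm a t = χ t * mulForm b t :=
            DFunLike.congr_fun (ha.2.trans hb.2.symm) t
          refine mul_left_cancel₀ (fun h0 => ?_) h3
          have h4 : χ t⁻¹ * χ t = 1 := by rw [← map_mul, inv_mul_cancel, map_one]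
          rw [h0, mul_zero] at h4
          exact zero_ne_one h4
        omega

lemma unipMult_zero_eq_one {χ : Fˣ →* ℂ} (hχ : χ * χ = 1) {V : FDRep ℂ (SL2 F)} [Simple V]
    (h : 0 < borelMult χ V) : unipMult ψ 0 V = 1 := by
  classical
  have h1 : borelMult χ V = 1 := by
    have := borelMult_mul_le χ χ V
    rw [if_pos rfl, if_pos hχ] at this
    by_contra h2
    nlinarith [show 2 ≤ borelMult χ V by omega]
  rw [unipMult_zero_eq_sum, Finset.sum_eq_single (mulForm.symm χ), Equiv.apply_symm_apply, h1]
  · intro θ _ hθ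
    have h2 : χ ≠ mulForm θ := fun h => hθ (by rw [h, Equiv.symm_apply_apply])
    have h3 := borelMult_mul_le χ (mulForm θ) V
    rw [if_neg h2, if_neg, h1] at h3
    · omega
    · intro h
      apply h2
      calc χ = χ * (χ * mulForm θ) := by rw [h, mul_one]
        _ = mulForm θ := by rw [← mul_assoc, hχ, one_mul]
  · simp

lemma sum_borelMult_mul_finrank_nat (χ : Fˣ →* ℂ) :
    ∑ i : Irr (SL2 F), borelMult χ (irrep i) * Module.finrank ℂ (irrep i) =
      Fintype.card F + 1 := by
  have := sum_borelMult_mul_finrank χ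
  exact_mod_cast this

/-- Here the principal series is irreducible: its squared multiplicities sum to 1, so V accounts for
the whole degree q + 1. -/
lemma finrank_eq_of_borelMult_pos {χ : Fˣ →* ℂ} (hχ : χ * χ ≠ 1) {V : FDRep ℂ (SL2 F)} [Simple V]
    (h : 0 < borelMult χ V) : Module.finrank ℂ V = Fintype.card F + 1 := by
  classical
  obtain ⟨i, hi, ⟨e⟩⟩ := exists_iso_irrep V
  rw [borelMult_congr hi] at h
  rw [finrank_eq_of_iso e, ← sum_borelMult_mul_finrank_nat χ]
  have h1 := sum_borelMult_mul_nat χ χ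
  rw [if_pos rfl, if_neg hχ, ← Finset.add_sum_erase _ _ (Finset.mem_univ i)] at h1
  have h2 : borelMult χ (irrep i) = 1 := by
    by_contra h3
    have h4 : 2 * 2 ≤ borelMult χ (irrep i) * borelMult χ (irrep i) :=
      Nat.mul_le_mul (by omega) (by omega)
    omega
  rw [h2] at h1
  have h3 : ∑ j ∈ Finset.univ.erase i, borelMult χ (irrep j) * borelMult χ (irrep j) = 0 := by
    omega
  rw [Finset.sum_eq_zero_iff] at h3
  rw [← Finset.add_sum_erase _ _ (Finset.mem_univ i), h2, one_mul, Finset.sum_eq_zero, add_zero]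
  intro j hj
  rw [mul_self_eq_zero.1 (h3 j hj), zero_mul]

/-- Self-intertwining number 2 means two inequivalent constituents, each occurring once. -/
lemma exists_pair_of_mul_self_eq_one {χ : Fˣ →* ℂ} (hχ : χ * χ = 1) :
    ∃ i j : Irr (SL2 F), i ≠ j ∧ borelMult χ (irrep i) = 1 ∧ borelMult χ (irrep j) = 1 ∧
      (∀ k, k ≠ i → k ≠ j → borelMult χ (irrep k) = 0) ∧
      Module.finrank ℂ (irrep i) + Module.finrank ℂ (irrep j) = Fintype.card F + 1 := by
  classical
  have h := sum_borelMult_mul_nat χ χ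
  rw [if_pos rfl, if_pos hχ] at h
  obtain ⟨i, j, hij, hi, hj, hk⟩ := eq_pair_of_sum_mul_self_eq_two _ h
  refine ⟨i, j, hij, hi, hj, hk, ?_⟩
  rw [← sum_borelMult_mul_finrank_nat χ, Fintype.sum_eq_add i j hij, hi, hj, one_mul, one_mul]
  rintro k ⟨h1, h2⟩
  rw [hk k h1 h2, zero_mul]

end Borel

instance : Simple (𝟙_ (FDRep ℂ (SL2 F))) := by
  rcases simple_or_decomp (𝟙_ (FDRep ℂ (SL2 F))) (by
    change 0 < Module.finrank ℂ ℂ; simp) with h | ⟨W₁, W₂, ⟨e⟩, h1, h2⟩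
  · exact h
  · have h3 := finrank_eq_of_iso e
    rw [finrank_biprod] at h3
    have h4 : Module.finrank ℂ (𝟙_ (FDRep ℂ (SL2 F))) = 1 := Module.finrank_self ℂ
    omega

/-! ### Classification of irreps by unipotent multiplicities -/

section Table
variable [DecidableEq F] {ε : F}

/-- For χ = 1 one of the two constituents is trivial; the other is Steinberg, of dimension (q+1) -
1. -/
lemma finrank_of_borelMult_one {V : FDRep ℂ (SL2 F)} [Simple V]
    (h : 0 < borelMult 1 V) (hV : ¬ Nonempty (V ≅ 𝟙_ (FDRep ℂ (SL2 F)))) :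
    Module.finrank ℂ V = Fintype.card F := by
  obtain ⟨i, j, hij, hi, hj, hk, hd⟩ := exists_pair_of_mul_self_eq_one (F := F) (χ := 1) (mul_one 1)
  obtain ⟨k, hkc, ⟨e⟩⟩ := exists_iso_irrep V
  obtain ⟨l, hlc, ⟨e'⟩⟩ := exists_iso_irrep (𝟙_ (FDRep ℂ (SL2 F)))
  have hb := borelMult_trivial (F := F)
  rw [borelMult_congr hlc] at hb
  rw [borelMult_congr hkc] at h
  have hkl : k ≠ l := by
    rintro rfl
    exact hV ⟨e ≪≫ e'.symm⟩
  have h1 := finrank_eq_of_iso e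
  have h2 := finrank_eq_of_iso e'
  have h3 : Module.finrank ℂ (𝟙_ (FDRep ℂ (SL2 F))) = 1 := Module.finrank_self ℂ
  have mem (m : Irr (SL2 F)) (hm : 0 < borelMult 1 (irrep m)) : m = i ∨ m = j := by
    by_contra! hne
    have := hk m hne.1 hne.2
    omega
  rcases mem k h with rfl | rfl <;> rcases mem l hb with rfl | rfl
  · exact absurd rfl hkl
  · omega
  · omega
  · exact absurd rfl hkl

/-- The lower unitriangular matrices. -/
def lowerUnip (y : F) : SL2 F := ⟨!![1, 0; y, 1], by simp [Matrix.det_fin_two]⟩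

omit [Fintype F] [DecidableEq F] in
@[simp] lemma lowerUnip_apply_00 (y : F) : (lowerUnip y).1 0 0 = 1 := rfl
omit [Fintype F] [DecidableEq F] in
@[simp] lemma lowerUnip_apply_01 (y : F) : (lowerUnip y).1 0 1 = 0 := rfl
omit [Fintype F] [DecidableEq F] in
@[simp] lemma lowerUnip_apply_10 (y : F) : (lowerUnip y).1 1 0 = y := rfl
omit [Fintype F] [DecidableEq F] in
@[simp] lemma lowerUnip_apply_11 (y : F) : (lowerUnip y).1 1 1 = 1 := rfl

omit [Fintype F] [DecidableEq F] in
/-- If the upper unipotent matrices act trivially, so do all upper triangular matrices. -/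
lemma rho_upper_eq_one {V : FDRep ℂ (SL2 F)} (h : ∀ x : F, V.ρ (unip (.ofAdd x)) = 1) (t : Fˣ)
    (x : F) : V.ρ (upper t x) = 1 := by
  have h1 (y : F) : V.ρ (bigCell 1 0 0 * unip (.ofAdd y) * (bigCell 1 0 0)⁻¹) = 1 := by
    rw [rho_mul, rho_mul, h, mul_one, rho_mul_inv]
  have h2 (y : F) : bigCell 1 0 0 * unip (.ofAdd y) * (bigCell 1 0 0)⁻¹ = lowerUnip (-y) := by
    rw [mul_inv_eq_iff_eq_mul, SL2_ext_iff]
    simp only [SL2_mul_apply, unip_apply_00, unip_apply_01, unip_apply_10, unip_apply_11,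
      bigCell_apply_00, bigCell_apply_01, bigCell_apply_10, bigCell_apply_11, lowerUnip_apply_00,
      lowerUnip_apply_01, lowerUnip_apply_10, lowerUnip_apply_11, toAdd_ofAdd, inv_one,
      Units.val_one]
    refine ⟨by ring, by ring, by ring, by ring⟩
  have h4 (y : F) : V.ρ (lowerUnip y) = 1 := by
    rw [← neg_neg y, ← h2, h1]
  have ht : (t : F) ≠ 0 := t.ne_zero
  -- With w(t) = u(t) l(-t⁻¹) u(t), where u and l are upper and lower unitriangular, diag(t, t⁻¹) =
  -- w(t) w(-1); the last factor restores the entry x.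
  have h3 : upper t x = unip (.ofAdd (t : F)) * lowerUnip (-(t : F)⁻¹) * unip (.ofAdd (t : F)) *
      unip (.ofAdd (-1)) * lowerUnip 1 * unip (.ofAdd (-1)) * unip (.ofAdd ((t : F)⁻¹ * x)) := by
    rw [SL2_ext_iff]
    simp only [SL2_mul_apply, unip_apply_00, unip_apply_01, unip_apply_10, unip_apply_11,
      upper_apply_00, upper_apply_01, upper_apply_10, upper_apply_11, lowerUnip_apply_00,
      lowerUnip_apply_01, lowerUnip_apply_10, lowerUnip_apply_11, toAdd_ofAdd,
      Units.val_inv_eq_inv_val]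
    refine ⟨by field_simp; ring, by field_simp; ring, by field_simp; ring, by field_simp; ring⟩
  rw [h3]
  simp only [rho_mul, h, h4, mul_one]

lemma unip_eq_one_of_unipMult (hψ : ψ.IsPrimitive) (hε : quadraticChar F ε = -1)
    {V : FDRep ℂ (SL2 F)} (h1 : unipMult ψ 1 V = 0) (h2 : unipMult ψ ε V = 0) (x : F) :
    V.ρ (unip (.ofAdd x)) = 1 := by
  have h3 : Module.finrank ℂ V = unipMult ψ 0 V := by
    rw [finrank_eq_sum_unipMult hψ, Finset.sum_eq_single 0]
    · intro a _ ha
      rw [unipMult_eq_of_quadraticChar hε V ha, h1, h2]; simp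
    · simp
  have h4 : eigenvectors unip (AddChar.mulShift ψ 0).toMonoidHom V = ⊤ :=
    Submodule.eq_top_of_finrank_eq h3.symm
  ext v
  have h5 : v ∈ eigenvectors unip (AddChar.mulShift ψ 0).toMonoidHom V := h4 ▸ Submodule.mem_top
  rw [h5 (.ofAdd x)]
  change ψ (0 * x) • v = v
  rw [zero_mul, AddChar.map_zero_eq_one, one_smul]

omit [DecidableEq F] in
lemma three_le_card (hF : ringChar F ≠ 2) : 3 ≤ Fintype.card F := by
  have h1 := FiniteField.odd_card_of_char_ne_two hF
  have h2 := Fintype.one_lt_card (α := F)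
  omega

lemma unipMult_eq_one_of_borelMult_one (hψ : ψ.IsPrimitive) (hF : ringChar F ≠ 2)
    (hε : quadraticChar F ε = -1) {V : FDRep ℂ (SL2 F)} [Simple V]
    (h : 0 < borelMult 1 V) (hV : ¬ Nonempty (V ≅ 𝟙_ (FDRep ℂ (SL2 F)))) :
    unipMult ψ 1 V = 1 ∧ unipMult ψ ε V = 1 := by
  have hε0 : ε ≠ 0 := by
    rintro rfl; simp at hε
  have h1 := two_mul_finrank hψ hF hε V
  rw [finrank_of_borelMult_one h hV, unipMult_zero_eq_one (mul_one 1) h] at h1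
  have h5 := unipMult_le_one hψ one_ne_zero V
  have h6 := unipMult_le_one hψ hε0 V
  have h7 := three_le_card hF
  interval_cases unipMult ψ 1 V <;> interval_cases unipMult ψ ε V <;> simp at h1 ⊢ <;> omega

/-- U acts trivially, hence so does the Borel subgroup, and V is trivial or Steinberg; but Steinberg
has m_1 = m_ε = 1. -/
lemma trivial_of_unipMult_eq_zero (hψ : ψ.IsPrimitive) (hF : ringChar F ≠ 2)
    (hε : quadraticChar F ε = -1) {V : FDRep ℂ (SL2 F)} [Simple V]
    (h1 : unipMult ψ 1 V = 0) (h2 : unipMult ψ ε V = 0) :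
    Nonempty (V ≅ 𝟙_ (FDRep ℂ (SL2 F))) := by
  by_contra hV
  have h3 := rho_upper_eq_one (unip_eq_one_of_unipMult hψ hε h1 h2)
  have h4 : 0 < borelMult 1 V := by
    obtain ⟨v, hv⟩ := (Module.finrank_pos_iff_exists_ne_zero (R := ℂ)).1 (finrank_pos_of_simple V)
    refine (charMult_pos_iff _ _ V).2 ⟨v, hv, fun k => ?_⟩
    obtain ⟨⟨t, x⟩, rfl⟩ := borelEquiv.surjective k
    rw [borel_subtype_upper, h3]
    exact (one_smul ℂ v).symm
  have := unipMult_eq_one_of_borelMult_one hψ hF hε h4 hV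
  omega

/-- Both constituents of the quadratic principal series have m_0 = 1, and their dimensions add up to
q + 1, so their values of m_1 + m_ε add up to 2. Neither value is 0, since neither constituent is
trivial. -/
lemma unipMult_add_of_quadratic (hψ : ψ.IsPrimitive) (hF : ringChar F ≠ 2)
    (hε : quadraticChar F ε = -1) {χ : Fˣ →* ℂ} (hχ : χ * χ = 1) (hχ1 : χ ≠ 1)
    {V : FDRep ℂ (SL2 F)} [Simple V] (h : 0 < borelMult χ V) :
    unipMult ψ 1 V + unipMult ψ ε V = 1 := by
  obtain ⟨i, j, hij, hi, hj, hk, hd⟩ := exists_pair_of_mul_self_eq_one (F := F) hχ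
  obtain ⟨k, hkc, ⟨e⟩⟩ := exists_iso_irrep V
  rw [borelMult_congr hkc] at h
  have pos (m : Irr (SL2 F)) (hm : borelMult χ (irrep m) = 1) :
      0 < unipMult ψ 1 (irrep m) + unipMult ψ ε (irrep m) := by
    by_contra h0
    obtain ⟨e'⟩ := trivial_of_unipMult_eq_zero hψ hF hε (V := irrep m) (by omega) (by omega)
    have h1 := borelMult_mul_le 1 χ (irrep m)
    have h2 := borelMult_trivial (F := F)
    rw [← borelMult_congr (FDRep.char_iso e')] at h2
    rw [hm, one_mul, if_neg hχ1.symm, if_neg hχ1] at h1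
    omega
  have hi' := pos i hi
  have hj' := pos j hj
  have h1 := two_mul_finrank hψ hF hε (irrep i)
  have h2 := two_mul_finrank hψ hF hε (irrep j)
  rw [unipMult_zero_eq_one hχ (by omega)] at h1 h2
  have h3 : 2 * ((Fintype.card F : ℤ) + 1) = 4 + (Fintype.card F - 1) *
      ((unipMult ψ 1 (irrep i) + unipMult ψ ε (irrep i)) +
        (unipMult ψ 1 (irrep j) + unipMult ψ ε (irrep j))) := by
    have hd' : (Module.finrank ℂ (irrep i) : ℤ) + Module.finrank ℂ (irrep j) =
      Fintype.card F + 1 := by exact_mod_cast hd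
    linear_combination h1 + h2 - 2 * hd'
  have h7 := three_le_card hF
  have h4 : ((unipMult ψ 1 (irrep i) : ℤ) + unipMult ψ ε (irrep i)) +
        (unipMult ψ 1 (irrep j) + unipMult ψ ε (irrep j)) = 2 := by
    have h8 : ((Fintype.card F : ℤ) - 1) ≠ 0 := by omega
    apply mul_left_cancel₀ h8
    linear_combination -h3
  have hkij : k = i ∨ k = j := by
    by_contra! hne
    have := hk k hne.1 hne.2
    omega
  rw [unipMult_congr hkc, unipMult_congr hkc]
  rcases hkij with rfl | rfl <;> omega

/-- The classification of the irreducible representations of `SL2 F` by their restrictions to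
the unipotent subgroup. -/
lemma simple_cases (hψ : ψ.IsPrimitive) (hF : ringChar F ≠ 2) (hε : quadraticChar F ε = -1)
    (V : FDRep ℂ (SL2 F)) [Simple V] :
    Nonempty (V ≅ 𝟙_ (FDRep ℂ (SL2 F))) ∨
    (unipMult ψ 0 V ≤ 1 ∧ unipMult ψ 1 V + unipMult ψ ε V = 1) ∨
    (unipMult ψ 0 V ≤ 2 ∧ unipMult ψ 0 V ≠ 1 ∧ unipMult ψ 1 V = 1 ∧ unipMult ψ ε V = 1) ∨
    (unipMult ψ 0 V = 1 ∧ unipMult ψ 1 V = 1 ∧ unipMult ψ ε V = 1 ∧ 0 < borelMult 1 V) := by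
  have hε0 : ε ≠ 0 := by
    rintro rfl; simp at hε
  by_cases hV : Nonempty (V ≅ 𝟙_ (FDRep ℂ (SL2 F)))
  · exact .inl hV
  refine .inr ?_
  have h5 := unipMult_le_one hψ one_ne_zero V
  have h6 := unipMult_le_one hψ hε0 V
  have h0 : ¬ (unipMult ψ 1 V = 0 ∧ unipMult ψ ε V = 0) := fun h =>
    hV (trivial_of_unipMult_eq_zero hψ hF hε h.1 h.2)
  rcases Nat.eq_zero_or_pos (unipMult ψ 0 V) with hd | hd
  · omega
  · have hd' := hd
    rw [unipMult_zero_eq_sum] at hd'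
    obtain ⟨θ, -, hθ⟩ := Finset.exists_ne_zero_of_sum_ne_zero hd'.ne'
    have hθ' : 0 < borelMult (mulForm θ) V := Nat.pos_of_ne_zero hθ
    have hd2 := unipMult_zero_le_two (ψ := ψ) hθ'
    by_cases h1 : mulForm θ * mulForm θ = 1
    · have hd1 := unipMult_zero_eq_one (ψ := ψ) h1 hθ'
      by_cases h2 : mulForm θ = 1
      · rw [h2] at hθ'
        have h3 := unipMult_eq_one_of_borelMult_one hψ hF hε hθ' hV
        exact .inr (.inr ⟨hd1, h3.1, h3.2, hθ'⟩)
      · have := unipMult_add_of_quadratic hψ hF hε h1 h2 hθ'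
        omega
    · have h2 := two_mul_finrank hψ hF hε V
      -- Dimension q + 1 together with m_0 ≤ 2 forces m_0 = 2 and m_1 = m_ε = 1.
      rw [finrank_eq_of_borelMult_pos h1 hθ'] at h2
      have h7 := three_le_card hF
      push_cast at h2
      interval_cases unipMult ψ 1 V <;> interval_cases unipMult ψ ε V <;> simp at h2 h0 ⊢ <;> omega

end Table

end
end TensorRank

namespace TensorRank
noncomputable section
universe u

/-! ### Duals and tensor-hom adjunction -/

section Dual
variable {G : Type u} [Group G]

/-- The self-pairing of the dual character is again 1, whereas a proper decomposition would give at
least 2. -/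
lemma simple_dual [Finite G] (X : FDRep ℂ G) [Simple X] :
    Simple (FDRep.of (Representation.dual X.ρ)) := by
  have := Fintype.ofFinite G
  set D : FDRep ℂ G := FDRep.of (Representation.dual X.ρ) with hD
  have hc (g : G) : D.character g = X.character g⁻¹ := FDRep.char_dual X g
  have h1 : Module.finrank ℂ (D ⟶ D) = 1 := by
    have h2 := scalar_product_char D D
    simp only [hc, inv_inv, mul_comm (X.character _⁻¹)] at h2
    rw [scalar_product_char, FDRep.finrank_hom_simple_simple, if_pos ⟨Iso.refl X⟩] at h2
    exact_mod_cast h2.symm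
  have hpos : 0 < Module.finrank ℂ D := by
    have h2 := hc 1
    rw [inv_one, FDRep.char_one, FDRep.char_one] at h2
    have h3 : Module.finrank ℂ D = Module.finrank ℂ X := by exact_mod_cast h2
    rw [h3]
    exact finrank_pos_of_simple X
  have self_pos (W : FDRep ℂ G) (hW : 0 < Module.finrank ℂ W) :
      0 < Module.finrank ℂ (W ⟶ W) := by
    rw [Module.finrank_pos_iff_exists_ne_zero]
    refine ⟨𝟙 W, fun h => ?_⟩
    have h2 := char_zero ((IsZero.iff_id_eq_zero W).2 h) 1
    rw [FDRep.char_one] at h2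
    exact hW.ne' (by exact_mod_cast h2)
  rcases simple_or_decomp D hpos with h | ⟨W₁, W₂, ⟨e⟩, hW₁, hW₂⟩
  · exact h
  · have he := FDRep.char_iso e
    rw [finrank_hom_congr he he, finrank_hom_biprod_right, finrank_hom_comm _ W₁,
      finrank_hom_comm _ W₂, finrank_hom_biprod_right, finrank_hom_biprod_right] at h1
    have := self_pos W₁ hW₁
    have := self_pos W₂ hW₂
    omega

lemma finrank_dual (X : FDRep ℂ G) :
    Module.finrank ℂ (FDRep.of (Representation.dual X.ρ)) = Module.finrank ℂ X :=
  Subspace.dual_finrank_eq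

/-- Adjunction between X and its dual, read off from characters and symmetrised by
`finrank_hom_comm`. -/
lemma finrank_hom_dual_tensor [Finite G] (V X Y : FDRep ℂ G) :
    Module.finrank ℂ (V ⟶ tensorList [Y, FDRep.of (Representation.dual X.ρ)]) =
      Module.finrank ℂ (Y ⟶ V ⊗ X) := by
  have := Fintype.ofFinite G
  have h1 (g : G) : (tensorList [Y, FDRep.of (Representation.dual X.ρ)]).character g =
      Y.character g * X.character g⁻¹ := by
    have h2 : (𝟙_ (FDRep ℂ G)).character g = 1 :=
      (LinearMap.trace_id ℂ ℂ).trans (by simp)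
    simp only [tensorList, List.foldr_cons, List.foldr_nil, FDRep.char_tensor, Pi.mul_apply, h2,
      mul_one, FDRep.char_dual]
  rw [finrank_hom_comm Y]
  have h3 := scalar_product_char V (tensorList [Y, FDRep.of (Representation.dual X.ρ)])
  have h4 := scalar_product_char (V ⊗ X) Y
  have h5 : (Module.finrank ℂ (V ⟶ tensorList [Y, FDRep.of (Representation.dual X.ρ)]) : ℂ) =
      Module.finrank ℂ (V ⊗ X ⟶ Y) := by
    rw [← h3, ← h4]
    congr 1
    refine Finset.sum_congr rfl fun g _ => ?_
    rw [h1, FDRep.char_tensor, Pi.mul_apply]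
    ring
  exact_mod_cast h5

lemma exists_mono_of_finrank_pos {V W : FDRep ℂ G} [Simple V] (h : 0 < Module.finrank ℂ (V ⟶ W)) :
    ∃ f : V ⟶ W, Mono f := by
  obtain ⟨f, hf⟩ := (Module.finrank_pos_iff_exists_ne_zero (R := ℂ)).1 h
  exact ⟨f, mono_of_nonzero_from_simple hf⟩

lemma nonempty_iso_of_mono {V W : FDRep ℂ G} [Simple V] [Simple W] (f : V ⟶ W) [Mono f] :
    Nonempty (V ≅ W) := by
  have hf : f ≠ 0 := by
    rintro rfl
    refine Simple.not_isZero V ((IsZero.iff_id_eq_zero V).2 ?_)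
    rw [← cancel_mono (0 : V ⟶ W)]
    simp
  have := isIso_of_hom_simple hf
  exact ⟨asIso f⟩

end Dual

variable {F : Type u} [Field F] [Fintype F]

/-! ### The filtration steps in terms of irreps -/

section Filtration

lemma repClass_mem_tensorFiltration_iff (V : FDRep ℂ (SL2 F)) [Simple V] (k : ℕ) :
    repClass V ∈ tensorFiltration F k ↔ ∃ L : List (FDRep ℂ (SL2 F)), L.length ≤ k ∧
      (∀ W ∈ L, IsHalfIrrep W) ∧ ∃ f : V ⟶ tensorList L, Mono f := by
  constructor
  · intro h
    have h1 : tensorFiltration F k = AddSubgroup.closure {x | ∃ W : FDRep ℂ (SL2 F),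
        (Simple W ∧ ∃ L : List (FDRep ℂ (SL2 F)), L.length ≤ k ∧
          (∀ V ∈ L, IsHalfIrrep V) ∧ ∃ f : W ⟶ tensorList L, Mono f) ∧ x = repClass W} := by
      unfold tensorFiltration
      congr 1
      ext x
      constructor
      · rintro ⟨W, L, h1, h2, h3, h4, h5⟩
        exact ⟨W, ⟨h1, L, h2, h3, h4⟩, h5⟩
      · rintro ⟨W, ⟨h1, L, h2, h3, h4⟩, h5⟩
        exact ⟨W, L, h1, h2, h3, h4, h5⟩
    rw [h1] at h
    obtain ⟨W, ⟨-, L, h2, h3, f, hf⟩, ⟨e⟩⟩ :=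
      exists_iso_of_repClass_mem_closure (fun W hW => hW.1) h
    exact ⟨L, h2, h3, e.hom ≫ f, mono_comp _ _⟩
  · rintro ⟨L, h1, h2, h3⟩
    exact AddSubgroup.subset_closure ⟨V, L, inferInstance, h1, h2, h3, rfl⟩

lemma mem_tensorFiltration_zero_iff (V : FDRep ℂ (SL2 F)) [Simple V] :
    repClass V ∈ tensorFiltration F 0 ↔ Nonempty (V ≅ 𝟙_ (FDRep ℂ (SL2 F))) := by
  rw [repClass_mem_tensorFiltration_iff]
  constructor
  · rintro ⟨L, h1, -, f, hf⟩
    obtain rfl := List.length_eq_zero_iff.1 (Nat.le_zero.1 h1)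
    exact @nonempty_iso_of_mono _ _ V (𝟙_ (FDRep ℂ (SL2 F))) _ _ f hf
  · rintro ⟨e⟩
    exact ⟨[], le_rfl, by simp, e.hom, inferInstanceAs (Mono (Y := 𝟙_ (FDRep ℂ (SL2 F))) e.hom)⟩

lemma mem_tensorFiltration_one_iff (V : FDRep ℂ (SL2 F)) [Simple V] :
    repClass V ∈ tensorFiltration F 1 ↔
      Nonempty (V ≅ 𝟙_ (FDRep ℂ (SL2 F))) ∨ IsHalfIrrep V := by
  rw [repClass_mem_tensorFiltration_iff]
  constructor
  · rintro ⟨L, h1, h2, f, hf⟩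
    rcases L with - | ⟨A, L⟩
    · exact .inl (@nonempty_iso_of_mono _ _ V (𝟙_ (FDRep ℂ (SL2 F))) _ _ f hf)
    · obtain rfl : L = [] := by
        rw [List.length_cons] at h1
        exact List.length_eq_zero_iff.1 (by omega)
      have hA := h2 A (by simp)
      have := hA.1
      let g : V ⟶ A ⊗ 𝟙_ (FDRep ℂ (SL2 F)) := f
      have hg : Mono g := hf
      have hm : Mono (g ≫ (ρ_ A).hom) := mono_comp g (ρ_ A).hom
      obtain ⟨e⟩ := nonempty_iso_of_mono (g ≫ (ρ_ A).hom)
      refine .inr ⟨inferInstance, ?_⟩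
      rw [finrank_eq_of_iso e]
      exact hA.2
  · rintro (⟨⟨e⟩⟩ | h)
    · exact ⟨[], by simp, by simp, e.hom,
        inferInstanceAs (Mono (Y := 𝟙_ (FDRep ℂ (SL2 F))) e.hom)⟩
    · refine ⟨[V], le_rfl, by simpa using h, (ρ_ V).inv, ?_⟩
      exact inferInstanceAs (Mono (ρ_ V).inv)

/-- V embeds in Y ⊗ X*, and the dual X* is again a half irrep. -/
lemma mem_tensorFiltration_two_of_finrank_pos {V X Y : FDRep ℂ (SL2 F)} [Simple V]
    (hX : IsHalfIrrep X) (hY : IsHalfIrrep Y) (h : 0 < Module.finrank ℂ (Y ⟶ V ⊗ X)) :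
    repClass V ∈ tensorFiltration F 2 := by
  have := hX.1
  rw [repClass_mem_tensorFiltration_iff]
  rw [← finrank_hom_dual_tensor] at h
  refine ⟨_, le_rfl, ?_, exists_mono_of_finrank_pos h⟩
  simp only [List.mem_cons, List.not_mem_nil, or_false, forall_eq_or_imp, forall_eq]
  exact ⟨hY, simple_dual X, by rw [finrank_dual]; exact hX.2⟩

omit [Fintype F] in
lemma tensorFiltration_mono {j k : ℕ} (h : j ≤ k) :
    tensorFiltration F j ≤ tensorFiltration F k := by
  refine AddSubgroup.closure_mono ?_
  rintro x ⟨W, L, h1, h2, h3⟩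
  exact ⟨W, L, h1, h2.trans h, h3⟩

end Filtration

/-! ### Half irreps and their twofold products -/

variable [DecidableEq F] {ψ : AddChar F ℂ} {ε : F}

lemma isHalfIrrep_of_unipMult_ne (hψ : ψ.IsPrimitive) (hF : ringChar F ≠ 2)
    (hε : quadraticChar F ε = -1) {V : FDRep ℂ (SL2 F)} [Simple V]
    (h : unipMult ψ 1 V ≠ unipMult ψ ε V) : IsHalfIrrep V := by
  refine ⟨inferInstance, ?_⟩
  have h1 := two_mul_finrank hψ hF hε V
  have h2 := FiniteField.odd_card_of_char_ne_two hF
  have h3 := three_le_card hF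
  rw [Nat.card_eq_fintype_card]
  rcases simple_cases hψ hF hε V with ⟨⟨e⟩⟩ | h4 | h4 | h4
  · have h5 := FDRep.char_iso e
    have h6 : Module.finrank ℂ V = 1 := (finrank_eq_of_iso e).trans (Module.finrank_self ℂ)
    have h7 : unipMult ψ 0 V = 1 := by
      have h8 := borelMult_trivial (F := F)
      rw [← borelMult_congr h5] at h8
      exact unipMult_zero_eq_one (mul_one 1) h8
    rw [h6, h7] at h1
    have h8 : ((Fintype.card F : ℤ) - 1) * (unipMult ψ 1 V + unipMult ψ ε V) = 0 := by
      push_cast at h1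
      linarith
    rcases mul_eq_zero.1 h8 with h9 | h9 <;> omega
  · have h5 : (unipMult ψ 1 V : ℤ) + unipMult ψ ε V = 1 := by exact_mod_cast h4.2
    rw [h5] at h1
    omega
  · omega
  · omega

/-- The quadratic character of `Fˣ` with complex values. -/
def quadraticUnitsChar (F : Type u) [Field F] [Fintype F] [DecidableEq F] : Fˣ →* ℂ :=
  ((Int.castRingHom ℂ : ℤ →* ℂ).comp (quadraticChar F).toMonoidHom).comp (Units.coeHom F)

lemma quadraticUnitsChar_apply (t : Fˣ) :
    quadraticUnitsChar F t = ((quadraticChar F (t : F) : ℤ) : ℂ) := rfl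

lemma quadraticUnitsChar_mul_self : quadraticUnitsChar F * quadraticUnitsChar F = 1 := by
  ext t
  rw [MonoidHom.mul_apply, quadraticUnitsChar_apply, ← Int.cast_mul, ← sq,
    quadraticChar_sq_one t.ne_zero]
  simp

lemma quadraticUnitsChar_ne_one (hF : ringChar F ≠ 2) : quadraticUnitsChar F ≠ 1 := by
  intro h
  obtain ⟨t, ht⟩ := quadraticChar_exists_neg_one' hF
  have h1 := DFunLike.congr_fun h t
  rw [quadraticUnitsChar_apply, ht] at h1
  norm_num at h1

/-- A half irrep X is chosen so that V ⊗ X has a half constituent: by the asymmetry of m_1 and m_ε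
when m_0 ≠ 1, by a quadratic Borel eigenvector in the Steinberg case. -/
lemma repClass_mem_tensorFiltration_two (hψ : ψ.IsPrimitive) (hF : ringChar F ≠ 2)
    (hε : quadraticChar F ε = -1) (V : FDRep ℂ (SL2 F)) [Simple V] :
    repClass V ∈ tensorFiltration F 2 := by
  have hε0 : ε ≠ 0 := by
    rintro rfl; simp at hε
  rcases simple_cases hψ hF hε V with h | h | ⟨-, h0, h1, h2⟩ | ⟨h0, h1, h2, hb⟩
  · exact tensorFiltration_mono (Nat.zero_le 2) ((mem_tensorFiltration_zero_iff V).2 h)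
  · refine tensorFiltration_mono one_le_two ((mem_tensorFiltration_one_iff V).2 (.inr ?_))
    exact isHalfIrrep_of_unipMult_ne hψ hF hε (by omega)
  · obtain ⟨i, hi⟩ : ∃ i : Irr (SL2 F), unipMult ψ 1 (irrep i) ≠ unipMult ψ ε (irrep i) := by
      have h3 := card_unipMult_ne hψ hF hε
      obtain ⟨i, hi⟩ := Finset.card_pos.1 (by rw [h3]; norm_num)
      exact ⟨i, (Finset.mem_filter.1 hi).2⟩
    -- V|U is regular plus m_0 - 1 trivial copies (a virtual one if m_0 = 0); convolving with the
    -- regular part gives the constant dim X.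
    have h3 (c : F) : (unipMult ψ c (V ⊗ irrep i) : ℤ) =
        (unipMult ψ 0 V - 1) * unipMult ψ c (irrep i) + Module.finrank ℂ (irrep i) := by
      have h4 (a : F) : (unipMult ψ a V : ℤ) =
          1 + if a = 0 then (unipMult ψ 0 V : ℤ) - 1 else 0 := by
        split_ifs with ha
        · rw [ha]; ring
        · rw [unipMult_eq_of_quadraticChar hε V ha, h1, h2]; simp
      rw [unipMult_tensor hψ, finrank_eq_sum_unipMult hψ,
        ← Equiv.sum_comp (Equiv.subLeft c) (fun a => unipMult ψ a (irrep i))]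
      push_cast
      generalize (unipMult ψ 0 V : ℤ) = d at h4 ⊢
      simp only [h4, add_mul, one_mul, Finset.sum_add_distrib, ite_mul, zero_mul,
        Finset.sum_ite_eq', Finset.mem_univ, if_true, sub_zero, Equiv.subLeft_apply]
      ring
    have h4 : unipMult ψ 1 (V ⊗ irrep i) ≠ unipMult ψ ε (V ⊗ irrep i) := by
      intro h
      have h5 : ((unipMult ψ 0 V : ℤ) - 1) *
          (unipMult ψ 1 (irrep i) - unipMult ψ ε (irrep i)) = 0 := by
        have h6 := h3 1
        have h7 := h3 ε
        rw [h] at h6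
        linear_combination h7 - h6
      rcases mul_eq_zero.1 h5 with h6 | h6 <;> omega
    obtain ⟨j, hj, hj'⟩ : ∃ j : Irr (SL2 F), unipMult ψ 1 (irrep j) ≠ unipMult ψ ε (irrep j) ∧
        0 < Module.finrank ℂ (irrep j ⟶ V ⊗ irrep i) := by
      by_contra! H
      apply h4
      rw [unipMult_eq_sum, unipMult_eq_sum]
      refine Finset.sum_congr rfl fun j _ => ?_
      by_cases h5 : unipMult ψ 1 (irrep j) = unipMult ψ ε (irrep j)
      · rw [h5]
      · rw [Nat.le_zero.1 (H j h5), zero_mul, zero_mul]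
    exact mem_tensorFiltration_two_of_finrank_pos (isHalfIrrep_of_unipMult_ne hψ hF hε hi)
      (isHalfIrrep_of_unipMult_ne hψ hF hε hj) hj'
  · have hχ := quadraticUnitsChar_mul_self (F := F)
    have hχ1 := quadraticUnitsChar_ne_one hF
    have half {W : FDRep ℂ (SL2 F)} [Simple W] (hW : 0 < borelMult (quadraticUnitsChar F) W) :
        IsHalfIrrep W := by
      have := unipMult_add_of_quadratic hψ hF hε hχ hχ1 hW
      exact isHalfIrrep_of_unipMult_ne hψ hF hε (by omega)
    obtain ⟨i, -, -, hi, -⟩ := exists_pair_of_mul_self_eq_one hχ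
    have hi' : 0 < borelMult (quadraticUnitsChar F) (irrep i) := by omega
    -- The Borel-fixed vector of V tensored with the quadratic eigenvector of X.
    have h3 : 0 < borelMult (quadraticUnitsChar F) (V ⊗ irrep i) := by
      have h4 := charMult_tensor_pos _ _ _ hb hi'
      have h5 : ((1 : Fˣ →* ℂ).comp borelDiag) * (quadraticUnitsChar F).comp borelDiag =
          (quadraticUnitsChar F).comp borelDiag := by
        ext t; simp
      rwa [h5] at h4
    rw [borelMult_eq_sum] at h3
    obtain ⟨j, -, hj⟩ := Finset.exists_ne_zero_of_sum_ne_zero h3.ne'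
    exact mem_tensorFiltration_two_of_finrank_pos (half hi')
      (half (Nat.pos_of_ne_zero (right_ne_zero_of_mul hj)))
      (Nat.pos_of_ne_zero (left_ne_zero_of_mul hj))

lemma finrank_cases (hψ : ψ.IsPrimitive) (hF : ringChar F ≠ 2) (hε : quadraticChar F ε = -1)
    (V : FDRep ℂ (SL2 F)) [Simple V] :
    (Nonempty (V ≅ 𝟙_ (FDRep ℂ (SL2 F))) ∧ Module.finrank ℂ V = 1 ∧
      unipMult ψ 1 V = unipMult ψ ε V) ∨
    ((Module.finrank ℂ V = (Fintype.card F - 1) / 2 ∨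
      Module.finrank ℂ V = (Fintype.card F + 1) / 2) ∧ unipMult ψ 1 V ≠ unipMult ψ ε V) ∨
    ((Module.finrank ℂ V = Fintype.card F - 1 ∨ Module.finrank ℂ V = Fintype.card F ∨
      Module.finrank ℂ V = Fintype.card F + 1) ∧ unipMult ψ 1 V = unipMult ψ ε V) := by
  have h1 := two_mul_finrank hψ hF hε V
  have h2 := FiniteField.odd_card_of_char_ne_two hF
  have h3 := three_le_card hF
  rcases eq_or_ne (unipMult ψ 1 V) (unipMult ψ ε V) with h | h
  · rcases simple_cases hψ hF hε V with ⟨⟨e⟩⟩ | h4 | ⟨h0, -, h5, h6⟩ | ⟨h0, h5, h6, -⟩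
    · exact .inl ⟨⟨e⟩, (finrank_eq_of_iso e).trans (Module.finrank_self ℂ), h⟩
    · omega
    · refine .inr (.inr ⟨?_, h⟩)
      rw [h5, h6] at h1
      push_cast at h1
      omega
    · refine .inr (.inr ⟨?_, h⟩)
      rw [h5, h6] at h1
      push_cast at h1
      omega
  · have h4 := (isHalfIrrep_of_unipMult_ne hψ hF hε h).2
    rw [Nat.card_eq_fintype_card] at h4
    exact .inr (.inl ⟨h4, h⟩)

/-- For q = 3 the dimensions collide: (q-1)/2 = 1 and (q+1)/2 = q - 1. -/
lemma isHalfIrrep_iff (hψ : ψ.IsPrimitive) (hF : ringChar F ≠ 2) (hε : quadraticChar F ε = -1)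
    (hq : 3 < Fintype.card F) (V : FDRep ℂ (SL2 F)) [Simple V] :
    IsHalfIrrep V ↔ unipMult ψ 1 V ≠ unipMult ψ ε V := by
  refine ⟨fun h => ?_, isHalfIrrep_of_unipMult_ne hψ hF hε⟩
  have h1 := h.2
  rw [Nat.card_eq_fintype_card] at h1
  have h2 := FiniteField.odd_card_of_char_ne_two hF
  rcases finrank_cases hψ hF hε V with ⟨-, h3, h4⟩ | ⟨-, h4⟩ | ⟨h3, h4⟩
  · omega
  · exact h4
  · omega

/-- The isomorphism class of an irreducible representation. -/
def Irr.toSkeleton {G : Type u} [Group G] (i : Irr G) : Skeleton (FDRep ℂ G) := i.1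

lemma Irr.toSkeleton_injective {G : Type u} [Group G] :
    Function.Injective (Irr.toSkeleton : Irr G → Skeleton (FDRep ℂ G)) :=
  Subtype.val_injective

lemma Irr.toSkeleton_irrep {G : Type u} [Group G] (i : Irr G) :
    CategoryTheory.toSkeleton (irrep i) = i.toSkeleton :=
  toSkeleton_fromSkeleton_obj i.1

lemma ncard_isHalfIrrep (hψ : ψ.IsPrimitive) (hF : ringChar F ≠ 2) (hε : quadraticChar F ε = -1)
    (hq : 3 < Fintype.card F) :
    {x : Skeleton (FDRep ℂ (SL2 F)) | ∃ V, IsHalfIrrep V ∧ x = toSkeleton V}.ncard = 4 := by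
  have h1 : {x : Skeleton (FDRep ℂ (SL2 F)) | ∃ V, IsHalfIrrep V ∧ x = toSkeleton V} =
      Irr.toSkeleton '' ((Finset.univ.filter fun i : Irr (SL2 F) =>
        unipMult ψ 1 (irrep i) ≠ unipMult ψ ε (irrep i) : Finset (Irr (SL2 F))) :
          Set (Irr (SL2 F))) := by
    ext x
    constructor
    · rintro ⟨V, hV, rfl⟩
      have := hV.1
      obtain ⟨i, ⟨e⟩⟩ := exists_irrep V
      refine ⟨i, Finset.mem_coe.2 (Finset.mem_filter.2 ⟨Finset.mem_univ _, ?_⟩), ?_⟩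
      · have h2 := FDRep.char_iso e
        rw [← unipMult_congr h2, ← unipMult_congr h2]
        exact (isHalfIrrep_iff hψ hF hε hq V).1 hV
      · rw [← Irr.toSkeleton_irrep, toSkeleton_eq_toSkeleton_iff]
        exact ⟨e.symm⟩
    · rintro ⟨i, hi, rfl⟩
      exact ⟨irrep i, isHalfIrrep_of_unipMult_ne hψ hF hε
        (Finset.mem_filter.1 (Finset.mem_coe.1 hi)).2, i.toSkeleton_irrep.symm⟩
  rw [h1, Set.ncard_image_of_injective _ Irr.toSkeleton_injective, Set.ncard_coe_finset,
    card_unipMult_ne hψ hF hε]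

omit [Fintype F] [DecidableEq F] in
lemma exists_isPrimitive [Finite F] : ∃ ψ : AddChar F ℂ, ψ.IsPrimitive := by
  obtain ⟨ψ, hψ⟩ := AddChar.exists_apply_ne_zero.2 (one_ne_zero (α := F))
  exact ⟨ψ, AddChar.IsPrimitive.of_ne_one (AddChar.ne_one_iff.2 ⟨1, hψ⟩)⟩

end
end TensorRank

/-! ### The theorem -/

open TensorRank in
theorem proposition2p1 {F : Type*} [Field F] [Finite F] (q : ℕ) (hq : Nat.card F = q)
    (hodd : Odd q) :
    (tensorFiltration F 2 = ⊤) ∧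
    (∀ V : FDRep ℂ (SL2 F), Simple V →
      (HasTensorRank V 0 ∨ HasTensorRank V 1 ∨ HasTensorRank V 2) ∧
      (HasTensorRank V 0 ↔ Nonempty (V ≅ 𝟙_ (FDRep ℂ (SL2 F))))) ∧
    (3 < q →
      {x : Skeleton (FDRep ℂ (SL2 F)) | ∃ V, IsHalfIrrep V ∧ x = toSkeleton V}.ncard = 4 ∧
      ∀ V : FDRep ℂ (SL2 F), Simple V →
        (HasTensorRank V 1 ↔
          Module.finrank ℂ V = (q - 1) / 2 ∨ Module.finrank ℂ V = (q + 1) / 2) ∧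
        (HasTensorRank V 2 ↔
          Module.finrank ℂ V = q - 1 ∨ Module.finrank ℂ V = q ∨
            Module.finrank ℂ V = q + 1)) := by
  classical
  have := Fintype.ofFinite F
  rw [Nat.card_eq_fintype_card] at hq
  have h2 : q % 2 = 1 := Nat.odd_iff.1 hodd
  have hF : ringChar F ≠ 2 := by
    intro h
    have := FiniteField.even_card_iff_char_two.1 h
    omega
  obtain ⟨ψ, hψ⟩ := exists_isPrimitive (F := F)
  obtain ⟨ε, hε⟩ := quadraticChar_exists_neg_one hF
  have rank_zero (V : FDRep ℂ (SL2 F)) [Simple V] :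
      HasTensorRank V 0 ↔ Nonempty (V ≅ 𝟙_ (FDRep ℂ (SL2 F))) := by
    rw [← mem_tensorFiltration_zero_iff]
    exact ⟨fun h => h.1, fun h => ⟨h, fun j hj => by omega⟩⟩
  have rank_succ (V : FDRep ℂ (SL2 F)) (k : ℕ) : HasTensorRank V (k + 1) ↔
      repClass V ∈ tensorFiltration F (k + 1) ∧ repClass V ∉ tensorFiltration F k := by
    refine and_congr_right fun _ => ⟨fun h => h k rfl, fun h j hj => ?_⟩
    obtain rfl : k = j := by omega
    exact h
  have top (V : FDRep ℂ (SL2 F)) [Simple V] := repClass_mem_tensorFiltration_two hψ hF hε V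
  refine ⟨?_, fun V hV => ⟨?_, rank_zero V⟩, fun hq3 => ⟨?_, fun V hV => ?_⟩⟩
  · rw [eq_top_iff, ← closure_repClass_eq_top, AddSubgroup.closure_le]
    rintro _ ⟨V, hV, rfl⟩
    exact top V
  · rw [rank_succ V 0, rank_succ V 1, rank_zero V, ← mem_tensorFiltration_zero_iff]
    have := top V
    tauto
  · exact ncard_isHalfIrrep hψ hF hε (by omega)
  -- For odd q > 3 the values 1, (q±1)/2 and q-1, q, q+1 are distinct, so the dimension determines
  -- the case.
  · have hc := finrank_cases hψ hF hε V
    have hh := isHalfIrrep_iff hψ hF hε (by omega) V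
    rw [rank_succ V 0, rank_succ V 1, mem_tensorFiltration_zero_iff, zero_add,
      mem_tensorFiltration_one_iff, hh]
    have hone : Nonempty (V ≅ 𝟙_ (FDRep ℂ (SL2 F))) → Module.finrank ℂ V = 1 := fun ⟨e⟩ =>
      (finrank_eq_of_iso e).trans (Module.finrank_self ℂ)
    rw [hq] at hc
    have := top V
    constructor
    · constructor
      · rintro ⟨h3 | h3, h4⟩
        · exact absurd h3 h4
        · rcases hc with ⟨-, -, h5⟩ | ⟨h5, -⟩ | ⟨-, h5⟩
          · exact absurd h5 h3
          · exact h5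
          · exact absurd h5 h3
      · intro h3
        refine ⟨.inr ?_, fun h4 => ?_⟩
        · rcases hc with ⟨-, h5, -⟩ | ⟨-, h5⟩ | ⟨h5, -⟩
          · omega
          · exact h5
          · omega
        · have := hone h4
          omega
    · constructor
      · rintro ⟨-, h3⟩
        rw [not_or] at h3
        rcases hc with ⟨h5, -⟩ | ⟨-, h5⟩ | ⟨h5, -⟩
        · exact absurd h5 h3.1
        · exact absurd h5 h3.2
        · exact h5
      · intro h3
        refine ⟨this, ?_⟩
        rintro (h4 | h4)
        · have := hone h4
          omega
        · rcases hc with ⟨-, -, h5⟩ | ⟨h5, -⟩ | ⟨-, h5⟩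
          · exact absurd h5 h4
          · omega
          · exact absurd h5 h4
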